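/- Let $h,c,k>0$ and let $B_\nu(T)=\frac{2h\nu^3}{c^2}\frac{1}{e^{h\nu/(kT)}-1}$ for $\nu,T>0$, $B_\nu(0)=0$. Let $\Omega\subset\mathbb R^3$ be a non-empty bounded convex open set with $C^1$ boundary and outward unit normal $n_x$ at $x\in\partial\Omega$. Let $\alpha_\nu\ge 0$ ($\nu>0$) depend only on the frequency $\nu$, with $\int_0^\infty\alpha_\nu\,d\nu<\infty$, and let $g_\nu(n)\ge 0$ satisfy $g_\nu(n)\in L^1((0,\infty)_\nu\times\mathbb S^2_n)$ and $\alpha_\nu^2g_\nu(n)\in L^1((0,\infty)_\nu\times\mathbb S^2_n)$. Consider the system for an intensity $I_\nu(x,n)$ and a temperature $T(x)\ge 0$, $$n\cdot\nabla_xI_\nu=\alpha_\nu\,(B_\nu(T)-I_\nu)\quad\text{for } x\in\Omega,\ n\in\mathbb S^2,\ \nu>0,$$ $$I_\nu(x,n)=g_\nu(n)\quad\text{for } x\in\partial\Omega,\ n\cdot n_x<0,$$ $$\nabla_x\cdot\mathcal F=0\ \text{ in }\Omega,\qquad \mathcal F(x)=\int_0^\infty d\nu\int_{\mathbb S^2}n\,I_\nu(x,n)\,dn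 .$$ A solution is a pair of a measurable $T:\Omega\to[0,\infty)$ and an $I\in L^1((0,\infty)\times\Omega\times\mathbb S^2)$ such that, for almost every $(\nu,x,n)$, $I_\nu(\cdot,n)$ is absolutely continuous on the segment from the boundary point where the ray through $x$ in direction $n$ enters $\Omega$ (included) to $x$, and the first equation holds almost everywhere on this segment with $n\cdot\nabla_x$ the derivative along it; the boundary condition holds; and the last equation holds in the sense of distributions. Put $f(T)=\int_0^\infty\alpha_\nu B_\nu(T)\,d\nu$. Then the system has a solution with $f(T)\in L^\infty_{\ge0}(\Omega)$, the set of non-negative elements of $L^\infty(\Omega)$. Moreover, $f(T)$ is unique: if $(T_1,I_1)$ and $(T_2,I_2)$ are solutions with $f(T_1),f(T_2)\in L^\infty_{\ge0}(\Omega)$, then $f(T_1)=f(T_2)$ a.e. in $\Omega$. If $\alpha_\nu$ does not vanish for almost every $\nu>0$, then also $T_1=T_2$ a.e. in $\Omega$, that is, $T$ is unique. -/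

import Mathlib

open MeasureTheory Set Filter
open scoped Topology ContDiff

noncomputable section

namespace RadTransfer

/-- Euclidean space `ℝ³`. -/
abbrev E3 : Type := EuclideanSpace ℝ (Fin 3)

/-- The unit sphere of directions. -/
abbrev S2 : Type := Metric.sphere (0 : E3) 1

/-- Surface measure on the unit sphere (total mass `4π`). -/
def surf : Measure S2 := (volume : Measure E3).toSphere

/-- The frequency measure: Lebesgue measure on `(0, ∞)`. -/
def freq : Measure ℝ := volume.restrict (Ioi 0)

/-- Planck's black-body emission `B_ν(T)` with physical constants `h`, `c`, `k`, for temperatures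
`T ≥ 0`, with the limit value `0` at `T = 0`. -/
def planck (h c k ν T : ℝ) : ℝ :=
  if T = 0 then 0 else 2 * h * ν ^ 3 / c ^ 2 * (1 / (Real.exp (h * ν / (k * T)) - 1))

/-- The total emission `f(T) = ∫₀^∞ α_ν B_ν(T) dν`. -/
def emission (h c k : ℝ) (α : ℝ → ℝ) (T : ℝ) : ℝ :=
  ∫ ν, α ν * planck h c k ν T ∂freq

/-- `N` is the outward unit normal of `Ω` at `x`, a point near which `Ω` is the negativity set of
a `C¹` function whose gradient at `x` is a positive multiple of `N`. -/
def HasOutwardNormal (Ω : Set E3) (x N : E3) : Prop :=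
  ‖N‖ = 1 ∧ ∃ ρ : E3 → ℝ, ContDiffAt ℝ 1 ρ x ∧ ρ x = 0 ∧
    (∃ r : ℝ, 0 < r ∧ gradient ρ x = r • N) ∧ ∀ᶠ z in 𝓝 x, (z ∈ Ω ↔ ρ z < 0)

/-- The boundary of `Ω` is of class `C¹`. -/
def HasC1Boundary (Ω : Set E3) : Prop :=
  ∀ x ∈ frontier Ω, ∃ N : E3, HasOutwardNormal Ω x N

/-- The distance `s(x, n)` from `x` backwards in direction `-n` to the boundary of the bounded
convex open set `Ω`. -/
def exitTime (Ω : Set E3) (x : E3) (n : S2) : ℝ :=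
  sSup {t : ℝ | 0 ≤ t ∧ x - t • (n : E3) ∈ Ω}

/-- The boundary point `y(x, n) = x - s(x, n) n` at which the ray through `x` in direction `n`
enters `Ω`. -/
def entryPoint (Ω : Set E3) (x : E3) (n : S2) : E3 :=
  x - exitTime Ω x n • (n : E3)

/-- The flux of radiation energy `F(x) = ∫₀^∞ dν ∫_{S²} n I_ν(x, n) dn`. -/
def flux (I : ℝ → E3 → S2 → ℝ) (x : E3) : E3 :=
  ∫ ν, (∫ n, I ν x n • (n : E3) ∂surf) ∂freq

/-- `∇ · F = 0` in `Ω` in the sense of distributions. -/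
def DivFree (Ω : Set E3) (F : E3 → E3) : Prop :=
  ∀ φ : E3 → ℝ, ContDiff ℝ ∞ φ → HasCompactSupport φ → tsupport φ ⊆ Ω →
    ∫ x in Ω, inner ℝ (F x) (gradient φ x) = 0

/-- `(T, I)` solves the stationary radiative transfer equation with emission and absorption only,
`n · ∇ₓ I_ν = α_ν (B_ν(T) - I_ν)` in `Ω`, with incoming boundary values `g_ν(n)` and
divergence-free flux. -/
structure IsSolution (h c k : ℝ) (Ω : Set E3) (α : ℝ → ℝ) (g : ℝ → S2 → ℝ)
    (T : E3 → ℝ) (I : ℝ → E3 → S2 → ℝ) : Prop where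
  /-- The temperature is measurable. -/
  aemeasurable : AEMeasurable T (volume.restrict Ω)
  /-- The (absolute) temperature is non-negative. -/
  nonneg : ∀ᵐ x ∂(volume.restrict Ω), 0 ≤ T x
  /-- The intensity is integrable, so that the flux is defined almost everywhere. -/
  integrable : Integrable (fun p : ℝ × E3 × S2 => I p.1 p.2.1 p.2.2)
    (freq.prod ((volume.restrict Ω).prod surf))
  /-- The incoming boundary condition: `I_ν(x, n) = g_ν(n)` for `x ∈ ∂Ω`, `n · n_x < 0`. -/
  boundary : ∀ ν : ℝ, 0 < ν → ∀ x ∈ frontier Ω, ∀ N : E3, HasOutwardNormal Ω x N →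
    ∀ n : S2, inner ℝ (n : E3) N < 0 → I ν x n = g ν n
  /-- The transfer equation: along almost every ray, from its entry point (included) on, `I_ν` is
  absolutely continuous and its derivative along the ray, `n · ∇ₓ I_ν`, equals
  `α_ν (B_ν(T) - I_ν)` almost everywhere. -/
  transport : ∀ᵐ p ∂(freq.prod ((volume.restrict Ω).prod surf)),
    AbsolutelyContinuousOnInterval
      (fun t : ℝ => I p.1 (entryPoint Ω p.2.1 p.2.2 + t • (p.2.2 : E3)) p.2.2)
      0 (exitTime Ω p.2.1 p.2.2) ∧
    ∀ᵐ t ∂(volume.restrict (Ioo 0 (exitTime Ω p.2.1 p.2.2))),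
      HasDerivAt (fun t : ℝ => I p.1 (entryPoint Ω p.2.1 p.2.2 + t • (p.2.2 : E3)) p.2.2)
        (α p.1 * (planck h c k p.1 (T (entryPoint Ω p.2.1 p.2.2 + t • (p.2.2 : E3)))
          - I p.1 (entryPoint Ω p.2.1 p.2.2 + t • (p.2.2 : E3)) p.2.2)) t
  /-- Conservation of the radiation energy. -/
  conservation : DivFree Ω (flux I)

/-- `T` is a temperature distribution solving the system, with `f(T)` a non-negative element of
`L^∞(Ω)`. -/
def IsTemperatureSolution (h c k : ℝ) (Ω : Set E3) (α : ℝ → ℝ) (g : ℝ → S2 → ℝ)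
    (T : E3 → ℝ) : Prop :=
  MemLp (fun x => emission h c k α (T x)) ⊤ (volume.restrict Ω) ∧
  (∀ᵐ x ∂(volume.restrict Ω), 0 ≤ emission h c k α (T x)) ∧
  ∃ I : ℝ → E3 → S2 → ℝ, IsSolution h c k Ω α g T I

end RadTransfer

end

/-!
Along a ray that enters `Ω` at a boundary point, the transfer equation is a linear ordinary
differential equation, and its absolutely continuous solution with initial value `g` is
`I = g + ∫₀^∞ α e^{-ατ} 1_Ω(x - τn) (B(T(x - τn)) - g) dτ`. The indicator function replaces the exit
time because `Ω` is convex, and subtracting `g` from the source accounts for the attenuation of the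
incoming radiation. The entry condition `n · n_x < 0` holds at every entry point, as a convex open
set lies strictly on one side of its tangent planes (`inner_sub_outwardNormal_neg`). Hence the
temperature determines the intensity (`IsData.ae_eq_intensity`).

Tested against `φ`, the equation reads `∫_Ω I n·∇φ = ∫_Ω α (I - B) φ`. For the formula above this
follows from Fubini's theorem and the translation invariance of Lebesgue measure: the adjoint of
averaging along rays is averaging along the reversed rays (`integral_attenuate_mul`), and there the
derivative along the ray can be integrated by parts. Integrated over frequencies and directions,
this says that the flux is divergence-free if and only if the emission `4π f(T)` equals the
absorption `∫∫ α I` almost everywhere (`IsData.divFree_flux_intensity_iff`).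

*Existence.* The absorption is a monotone function of the temperature. It is bounded by `4π f(M)`
for all temperatures at most `M`, if the constant `M` is large: at each frequency at least the
fraction `e^{-αD}` of the radiation emitted at temperature `M` escapes from a set of diameter `D`,
and this grows at least linearly in `M`, while the incoming radiation is fixed
(`IsData.exists_absorption_le`). So the iteration that starts at `T = 0` and chooses the next
temperature to emit what the present one makes absorbed increases to a solution.

*Uniqueness.* Unless `α` vanishes, `f` is strictly increasing and grows at least linearly, so
temperatures with `f(T)` bounded are bounded. As Planck's law is monotone in the temperature,
`4π |f(T₁) - f(T₂)|` is the integral of `w = α |B(T₁) - B(T₂)|` over frequencies and directions, and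
by the balance it is at most the integral of `α` times the average of `|B(T₁) - B(T₂)|` along rays.
Averaging reduces the integral over `Ω`, again because the fraction `e^{-αD}` is lost, so `w`
vanishes (`IsData.emission_unique`).

The factor `4π`, the area of the sphere, appears below as `surf.real univ`.
-/

noncomputable section

namespace RadTransfer

/-! ### Planck's law and the total emission -/

section Planck

variable {h c k : ℝ}

lemma cubic_add_quintic_le_exp_sub_one {q : ℝ} (hq : 0 ≤ q) :
    q ^ 3 / 6 + q ^ 5 / 120 ≤ Real.exp q - 1 := by
  have := Real.sum_le_exp_of_nonneg hq 6
  simp only [Finset.sum_range_succ, Finset.sum_range_zero, Nat.factorial] at this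
  norm_num at this
  have h2 : 0 ≤ q ^ 2 := by positivity
  have h4 : 0 ≤ q ^ 4 := by positivity
  linarith

lemma planck_of_pos {T : ℝ} (hT : 0 < T) (ν : ℝ) :
    planck h c k ν T = 2 * h * ν ^ 3 / c ^ 2 * (1 / (Real.exp (h * ν / (k * T)) - 1)) :=
  if_neg hT.ne'

@[simp] lemma planck_zero (ν : ℝ) : planck h c k ν 0 = 0 := if_pos rfl

lemma exp_sub_one_pos_of_pos (hh : 0 < h) (hk : 0 < k) {ν T : ℝ} (hν : 0 < ν) (hT : 0 < T) :
    0 < Real.exp (h * ν / (k * T)) - 1 := by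
  have : 0 < h * ν / (k * T) := by positivity
  have := Real.add_one_lt_exp this.ne'
  linarith

lemma planck_pos (hh : 0 < h) (hc : 0 < c) (hk : 0 < k) {ν T : ℝ} (hν : 0 < ν) (hT : 0 < T) :
    0 < planck h c k ν T := by
  have := exp_sub_one_pos_of_pos hh hk hν hT
  rw [planck_of_pos hT]
  positivity

lemma planck_nonneg (hh : 0 < h) (hc : 0 < c) (hk : 0 < k) {ν T : ℝ} (hν : 0 < ν) (hT : 0 ≤ T) :
    0 ≤ planck h c k ν T := by
  rcases hT.eq_or_lt with rfl | hT
  · simp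
  · exact (planck_pos hh hc hk hν hT).le

lemma planck_strictMonoOn (hh : 0 < h) (hc : 0 < c) (hk : 0 < k) {ν : ℝ} (hν : 0 < ν) :
    StrictMonoOn (planck h c k ν) (Ici 0) := by
  intro T₁ h₁ T₂ h₂ h₁₂
  rcases (mem_Ici.1 h₁).eq_or_lt with rfl | h₁
  · simpa using planck_pos hh hc hk hν h₁₂
  have h₂ := h₁.trans h₁₂
  rw [planck_of_pos h₁, planck_of_pos h₂]
  have e₂ := exp_sub_one_pos_of_pos hh hk hν h₂
  have : h * ν / (k * T₂) < h * ν / (k * T₁) := by gcongr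
  have := Real.exp_lt_exp.2 this
  gcongr

lemma planck_mono (hh : 0 < h) (hc : 0 < c) (hk : 0 < k) {ν T₁ T₂ : ℝ} (hν : 0 < ν)
    (h₁ : 0 ≤ T₁) (h₁₂ : T₁ ≤ T₂) : planck h c k ν T₁ ≤ planck h c k ν T₂ :=
  (planck_strictMonoOn hh hc hk hν).monotoneOn h₁ (h₁.trans h₁₂) h₁₂

lemma measurable_planck : Measurable fun p : ℝ × ℝ => planck h c k p.1 p.2 := by
  unfold planck
  refine Measurable.ite (measurable_snd (measurableSet_singleton 0)) measurable_const ?_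
  fun_prop

/-- `B_ν(T)` is bounded by an integrable and bounded function of the frequency. -/
lemma planck_le_div_one_add_sq (hh : 0 < h) (hc : 0 < c) (hk : 0 < k) {T : ℝ} (hT : 0 ≤ T) :
    ∃ C : ℝ, 0 ≤ C ∧ ∀ ν, 0 < ν → planck h c k ν T ≤ C * (1 + ν ^ 2)⁻¹ := by
  rcases hT.eq_or_lt with rfl | hT
  · exact ⟨0, le_rfl, fun ν _ => by simp⟩
  obtain ⟨r, hr, hr'⟩ : ∃ r : ℝ, 0 < r ∧ ∀ ν, h * ν / (k * T) = r * ν :=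
    ⟨h / (k * T), by positivity, fun ν => by ring⟩
  refine ⟨2 * h / c ^ 2 * (6 / r ^ 3 + 120 / r ^ 5), by positivity, fun ν hν => ?_⟩
  have e := exp_sub_one_pos_of_pos hh hk hν hT
  rw [planck_of_pos hT]
  rw [hr'] at e ⊢
  have key := cubic_add_quintic_le_exp_sub_one (q := r * ν) (by positivity)
  rw [← div_eq_mul_inv, le_div_iff₀ (by positivity)]
  have h1 : ν ^ 3 * (1 + ν ^ 2) ≤ (6 / r ^ 3 + 120 / r ^ 5) * (Real.exp (r * ν) - 1) := by
    calc ν ^ 3 * (1 + ν ^ 2)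
        = 6 / r ^ 3 * ((r * ν) ^ 3 / 6) + 120 / r ^ 5 * ((r * ν) ^ 5 / 120) := by
          field_simp
      _ ≤ 6 / r ^ 3 * ((r * ν) ^ 3 / 6 + (r * ν) ^ 5 / 120)
          + 120 / r ^ 5 * ((r * ν) ^ 3 / 6 + (r * ν) ^ 5 / 120) := by
          gcongr
          · exact le_add_of_nonneg_right (by positivity)
          · exact le_add_of_nonneg_left (by positivity)
      _ = (6 / r ^ 3 + 120 / r ^ 5) * ((r * ν) ^ 3 / 6 + (r * ν) ^ 5 / 120) := by ring
      _ ≤ _ := by gcongr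
  calc 2 * h * ν ^ 3 / c ^ 2 * (1 / (Real.exp (r * ν) - 1)) * (1 + ν ^ 2)
      = 2 * h / c ^ 2 * ((ν ^ 3 * (1 + ν ^ 2)) / (Real.exp (r * ν) - 1)) := by ring
    _ ≤ 2 * h / c ^ 2 * (6 / r ^ 3 + 120 / r ^ 5) := by
        gcongr
        rwa [div_le_iff₀ e]

/-- Convexity of the exponential makes `B_ν(T)` grow at least linearly for `T ≥ 1`. -/
lemma mul_planck_one_le (hh : 0 < h) (hc : 0 < c) (hk : 0 < k) {ν T : ℝ} (hν : 0 < ν)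
    (hT : 1 ≤ T) : T * planck h c k ν 1 ≤ planck h c k ν T := by
  have hT0 : 0 < T := by linarith
  rw [planck_of_pos hT0, planck_of_pos one_pos]
  have e := exp_sub_one_pos_of_pos hh hk hν hT0
  have e1 := exp_sub_one_pos_of_pos hh hk hν one_pos
  have key : T * (Real.exp (h * ν / (k * T)) - 1) ≤ Real.exp (h * ν / (k * 1)) - 1 := by
    have hb := one_add_mul_self_le_rpow_one_add (s := Real.exp (h * ν / (k * T)) - 1) (p := T)
      (by linarith) hT
    rw [add_sub_cancel, ← Real.exp_mul] at hb
    have : h * ν / (k * T) * T = h * ν / (k * 1) := by field_simp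
    rw [this] at hb
    linarith
  calc T * (2 * h * ν ^ 3 / c ^ 2 * (1 / (Real.exp (h * ν / (k * 1)) - 1)))
      = 2 * h * ν ^ 3 / c ^ 2 * (T / (Real.exp (h * ν / (k * 1)) - 1)) := by ring
    _ ≤ _ := by
        gcongr 2 * h * ν ^ 3 / c ^ 2 * ?_
        rw [div_le_div_iff₀ e1 e]
        linarith

lemma continuousOn_planck (hh : 0 < h) (hc : 0 < c) (hk : 0 < k) {ν : ℝ} (hν : 0 < ν) :
    ContinuousOn (planck h c k ν) (Ici 0) := by
  intro T hT
  rcases (mem_Ici.1 hT).eq_or_lt with rfl | hT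
  · have hb : ∀ T ∈ Ici (0 : ℝ), planck h c k ν T ≤ 2 * h * ν ^ 3 / c ^ 2 * (k / (h * ν)) * T := by
      intro T hT
      rcases (mem_Ici.1 hT).eq_or_lt with rfl | hT
      · simp
      rw [planck_of_pos hT]
      have e := exp_sub_one_pos_of_pos hh hk hν hT
      have : h * ν / (k * T) ≤ Real.exp (h * ν / (k * T)) - 1 := by
        linarith [Real.add_one_le_exp (h * ν / (k * T))]
      calc _ ≤ 2 * h * ν ^ 3 / c ^ 2 * (1 / (h * ν / (k * T))) := by gcongr
        _ = _ := by field_simp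
    have h0 : Tendsto (fun T => 2 * h * ν ^ 3 / c ^ 2 * (k / (h * ν)) * T) (𝓝[Ici 0] 0) (𝓝 0) := by
      have : Continuous fun T : ℝ => 2 * h * ν ^ 3 / c ^ 2 * (k / (h * ν)) * T := by fun_prop
      simpa using (this.tendsto 0).mono_left nhdsWithin_le_nhds
    rw [ContinuousWithinAt, planck_zero]
    refine tendsto_of_tendsto_of_tendsto_of_le_of_le' tendsto_const_nhds h0 ?_ ?_
    · filter_upwards [self_mem_nhdsWithin] with T hT using planck_nonneg hh hc hk hν hT
    · filter_upwards [self_mem_nhdsWithin] with T hT using hb T hT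
  · have e := exp_sub_one_pos_of_pos hh hk hν hT
    have hc1 : ContinuousAt
        (fun T => 2 * h * ν ^ 3 / c ^ 2 * (1 / (Real.exp (h * ν / (k * T)) - 1))) T := by
      refine continuousAt_const.mul (continuousAt_const.div ?_ e.ne')
      refine (Real.continuous_exp.continuousAt.comp ?_).sub continuousAt_const
      exact continuousAt_const.div (by fun_prop) (by positivity)
    refine (hc1.congr ?_).continuousWithinAt
    filter_upwards [lt_mem_nhds hT] with T hT using (planck_of_pos hT ν).symm

lemma ae_freq_pos : ∀ᵐ ν ∂freq, 0 < ν := ae_restrict_mem measurableSet_Ioi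

lemma integrable_planck (hh : 0 < h) (hc : 0 < c) (hk : 0 < k) {T : ℝ} (hT : 0 ≤ T) :
    Integrable (fun ν => planck h c k ν T) freq := by
  obtain ⟨C, hC0, hC⟩ := planck_le_div_one_add_sq hh hc hk hT
  refine ((integrable_inv_one_add_sq.const_mul C).restrict (s := Ioi 0)).mono'
    (measurable_planck.comp (measurable_id.prodMk measurable_const)).aestronglyMeasurable ?_
  filter_upwards [ae_freq_pos] with ν hν
  rw [Real.norm_of_nonneg (planck_nonneg hh hc hk hν hT)]
  exact hC ν hν

variable {α : ℝ → ℝ}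

lemma integrable_mul_planck (hh : 0 < h) (hc : 0 < c) (hk : 0 < k) (hα : Integrable α freq) {T : ℝ}
    (hT : 0 ≤ T) : Integrable (fun ν => α ν * planck h c k ν T) freq := by
  obtain ⟨C, hC0, hC⟩ := planck_le_div_one_add_sq hh hc hk hT
  refine hα.mul_bdd (c := C)
    (measurable_planck.comp (measurable_id.prodMk measurable_const)).aestronglyMeasurable ?_
  filter_upwards [ae_freq_pos] with ν hν
  rw [Real.norm_of_nonneg (planck_nonneg hh hc hk hν hT)]
  exact (hC ν hν).trans (mul_le_of_le_one_right hC0 (inv_le_one_of_one_le₀ (by nlinarith)))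

@[simp] lemma emission_zero : emission h c k α 0 = 0 := by simp [emission]

lemma emission_monotoneOn (hh : 0 < h) (hc : 0 < c) (hk : 0 < k) (hα0 : ∀ ν, 0 ≤ α ν)
    (hα : Integrable α freq) : MonotoneOn (emission h c k α) (Ici 0) := by
  intro T₁ h₁ T₂ h₂ h₁₂
  refine integral_mono_ae (integrable_mul_planck hh hc hk hα h₁)
    (integrable_mul_planck hh hc hk hα h₂) ?_
  filter_upwards [ae_freq_pos] with ν hν
  exact mul_le_mul_of_nonneg_left (planck_mono hh hc hk hν h₁ h₁₂) (hα0 ν)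

lemma emission_nonneg (hh : 0 < h) (hc : 0 < c) (hk : 0 < k) (hα0 : ∀ ν, 0 ≤ α ν)
    (hα : Integrable α freq) {T : ℝ} (hT : 0 ≤ T) : 0 ≤ emission h c k α T := by
  simpa using emission_monotoneOn hh hc hk hα0 hα self_mem_Ici hT hT

lemma emission_strictMonoOn (hh : 0 < h) (hc : 0 < c) (hk : 0 < k) (hα0 : ∀ ν, 0 ≤ α ν)
    (hα : Integrable α freq) (hne : ¬ ∀ᵐ ν ∂freq, α ν = 0) :
    StrictMonoOn (emission h c k α) (Ici 0) := by
  intro T₁ h₁ T₂ h₂ h₁₂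
  refine (emission_monotoneOn hh hc hk hα0 hα h₁ h₂ h₁₂.le).lt_of_ne fun heq => hne ?_
  have i₁ := integrable_mul_planck hh hc hk hα h₁
  have i₂ := integrable_mul_planck hh hc hk hα h₂
  have hz : ∫ ν, (α ν * planck h c k ν T₂ - α ν * planck h c k ν T₁) ∂freq = 0 := by
    rw [integral_sub i₂ i₁]
    exact sub_eq_zero.2 heq.symm
  rw [integral_eq_zero_iff_of_nonneg_ae
    (f := fun ν => α ν * planck h c k ν T₂ - α ν * planck h c k ν T₁) _ (i₂.sub i₁)] at hz
  · filter_upwards [hz, ae_freq_pos] with ν h0 hν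
    have hlt := planck_strictMonoOn hh hc hk hν h₁ h₂ h₁₂
    have h0 : α ν * (planck h c k ν T₂ - planck h c k ν T₁) = 0 := by
      rw [mul_sub]; exact h0
    exact (mul_eq_zero.1 h0).resolve_right (sub_pos.2 hlt).ne'
  · filter_upwards [ae_freq_pos] with ν hν
    have := mul_le_mul_of_nonneg_left (planck_mono hh hc hk hν h₁ h₁₂.le) (hα0 ν)
    simpa using this

lemma mul_emission_one_le (hh : 0 < h) (hc : 0 < c) (hk : 0 < k) (hα0 : ∀ ν, 0 ≤ α ν)
    (hα : Integrable α freq) {T : ℝ} (hT : 1 ≤ T) :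
    T * emission h c k α 1 ≤ emission h c k α T := by
  rw [emission, ← integral_const_mul]
  refine integral_mono_ae ((integrable_mul_planck hh hc hk hα zero_le_one).const_mul T)
    (integrable_mul_planck hh hc hk hα (by linarith)) ?_
  filter_upwards [ae_freq_pos] with ν hν
  have := mul_le_mul_of_nonneg_left (mul_planck_one_le hh hc hk hν hT) (hα0 ν)
  linarith

lemma continuousOn_emission (hh : 0 < h) (hc : 0 < c) (hk : 0 < k) (hα0 : ∀ ν, 0 ≤ α ν)
    (hα : Integrable α freq) : ContinuousOn (emission h c k α) (Ici 0) := by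
  intro T hT
  have hT1 : 0 ≤ T + 1 := by linarith [mem_Ici.1 hT]
  refine continuousWithinAt_of_dominated (bound := fun ν => α ν * planck h c k ν (T + 1)) ?_ ?_
    (integrable_mul_planck hh hc hk hα hT1) ?_
  · filter_upwards [self_mem_nhdsWithin] with S hS
    exact (integrable_mul_planck hh hc hk hα hS).aestronglyMeasurable
  · filter_upwards [self_mem_nhdsWithin,
      nhdsWithin_le_nhds (gt_mem_nhds (show T < T + 1 by linarith))] with S hS hS1
    filter_upwards [ae_freq_pos] with ν hν
    rw [Real.norm_of_nonneg (mul_nonneg (hα0 ν) (planck_nonneg hh hc hk hν hS))]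
    exact mul_le_mul_of_nonneg_left (planck_mono hh hc hk hν hS hS1.le) (hα0 ν)
  · filter_upwards [ae_freq_pos] with ν hν
    exact (continuousOn_planck hh hc hk hν T hT).const_mul _

end Planck

/-! ### Attenuated averages along rays -/

section Attenuation

/-- The weight `a e^{-aτ}` with which the source at distance `τ` back along the ray contributes. -/
def attKernel (a τ : ℝ) : ℝ := a * Real.exp (-a * τ)

/-- The attenuated average `∫₀^∞ a e^{-aτ} s(x - τv) dτ` of `s` along the ray arriving at `x` in
direction `v`. -/
def attenuate (a : ℝ) (v : E3) (s : E3 → ℝ) (x : E3) : ℝ :=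
  ∫ τ, attKernel a τ * s (x - τ • v) ∂freq

lemma attKernel_nonneg {a : ℝ} (ha : 0 ≤ a) (τ : ℝ) : 0 ≤ attKernel a τ :=
  mul_nonneg ha (Real.exp_pos _).le

@[fun_prop] lemma continuous_attKernel (a : ℝ) : Continuous (attKernel a) := by
  unfold attKernel; fun_prop

lemma hasDerivAt_exp_neg_mul (a τ : ℝ) :
    HasDerivAt (fun τ => -Real.exp (-a * τ)) (attKernel a τ) τ := by
  have := (((hasDerivAt_id τ).const_mul (-a)).exp).neg
  refine this.congr_deriv ?_
  simp [attKernel, mul_comm]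

lemma integrable_attKernel {a : ℝ} (ha : 0 ≤ a) : Integrable (attKernel a) freq := by
  rcases ha.eq_or_lt with rfl | ha
  · have : attKernel 0 = fun _ => 0 := by ext; simp [attKernel]
    simp [this]
  · exact (integrableOn_exp_mul_Ioi (neg_lt_zero.2 ha) 0).const_mul a

lemma integral_attKernel_Ioc {a D : ℝ} (hD : 0 ≤ D) :
    ∫ τ in Ioc 0 D, attKernel a τ = 1 - Real.exp (-a * D) := by
  rw [← intervalIntegral.integral_of_le hD,
    intervalIntegral.integral_eq_sub_of_hasDerivAt (fun τ _ => hasDerivAt_exp_neg_mul a τ)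
      (continuous_attKernel a).continuousOn.intervalIntegrable]
  simp; ring

lemma integral_attKernel_le_one {a : ℝ} (ha : 0 ≤ a) : ∫ τ, attKernel a τ ∂freq ≤ 1 := by
  rcases ha.eq_or_lt with rfl | ha
  · simp [attKernel]
  · have := integral_exp_mul_Ioi (neg_lt_zero.2 ha) 0
    simp only [attKernel, freq, integral_const_mul, this]
    simp [ha.ne']

variable {a : ℝ} {v : E3} {s s₁ s₂ : E3 → ℝ} {C : ℝ}

lemma integrable_attenuate (ha : 0 ≤ a) (hs : Measurable s) (hC : ∀ z, |s z| ≤ C) (x : E3) :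
    Integrable (fun τ => attKernel a τ * s (x - τ • v)) freq :=
  (integrable_attKernel ha).mul_bdd (c := C)
    (hs.comp (by fun_prop : Measurable fun τ : ℝ => x - τ • v)).aestronglyMeasurable
    (ae_of_all _ fun τ => hC _)

lemma attenuate_mono (ha : 0 ≤ a) (hs₁ : Measurable s₁) (hC₁ : ∀ z, |s₁ z| ≤ C)
    (hs₂ : Measurable s₂) {C' : ℝ} (hC₂ : ∀ z, |s₂ z| ≤ C') (h : ∀ z, s₁ z ≤ s₂ z) (x : E3) :
    attenuate a v s₁ x ≤ attenuate a v s₂ x :=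
  integral_mono (integrable_attenuate ha hs₁ hC₁ x) (integrable_attenuate ha hs₂ hC₂ x)
    fun τ => mul_le_mul_of_nonneg_left (h _) (attKernel_nonneg ha τ)

lemma attenuate_nonneg (ha : 0 ≤ a) (h : ∀ z, 0 ≤ s z) (x : E3) : 0 ≤ attenuate a v s x :=
  integral_nonneg fun τ => mul_nonneg (attKernel_nonneg ha τ) (h _)

lemma attenuate_sub (ha : 0 ≤ a) (hs₁ : Measurable s₁) (hC₁ : ∀ z, |s₁ z| ≤ C)
    (hs₂ : Measurable s₂) {C' : ℝ} (hC₂ : ∀ z, |s₂ z| ≤ C') (x : E3) :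
    attenuate a v (fun z => s₁ z - s₂ z) x = attenuate a v s₁ x - attenuate a v s₂ x := by
  simp only [attenuate, mul_sub]
  exact integral_sub (integrable_attenuate ha hs₁ hC₁ x) (integrable_attenuate ha hs₂ hC₂ x)

lemma attenuate_mul_const (r : ℝ) (x : E3) :
    attenuate a v (fun z => s z * r) x = attenuate a v s x * r := by
  simp only [attenuate, ← mul_assoc]
  exact integral_mul_const _ _

lemma attenuate_le (ha : 0 ≤ a) (hs : Measurable s) (hC : ∀ z, |s z| ≤ C) (hC0 : 0 ≤ C) (x : E3) :
    attenuate a v s x ≤ C := by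
  calc attenuate a v s x ≤ ∫ τ, attKernel a τ * C ∂freq :=
        integral_mono (integrable_attenuate ha hs hC x) ((integrable_attKernel ha).mul_const C)
          fun τ => mul_le_mul_of_nonneg_left ((le_abs_self _).trans (hC _)) (attKernel_nonneg ha τ)
    _ = (∫ τ, attKernel a τ ∂freq) * C := integral_mul_const _ _
    _ ≤ C := mul_le_of_le_one_left hC0 (integral_attKernel_le_one ha)

lemma abs_attenuate_le (ha : 0 ≤ a) (hs : Measurable s) (hC : ∀ z, |s z| ≤ C) (hC0 : 0 ≤ C)
    (x : E3) : |attenuate a v s x| ≤ C := by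
  refine abs_le.2 ⟨?_, attenuate_le ha hs hC hC0 x⟩
  have h1 := attenuate_le (v := v) (s := fun z => -s z) ha hs.neg (by simpa using hC) hC0 x
  simp only [attenuate, mul_neg, integral_neg] at h1 ⊢
  linarith

/-- At most the fraction `1 - e^{-aD}` of a ray is absorbed in a set of diameter at most `D`. -/
lemma attenuate_indicator_one_le {Ω : Set E3} (hΩ : MeasurableSet Ω) (ha : 0 ≤ a) (hv : ‖v‖ = 1)
    {D : ℝ} (hD0 : 0 ≤ D) (hD : ∀ x ∈ Ω, ∀ y ∈ Ω, ‖x - y‖ ≤ D) {x : E3} (hx : x ∈ Ω) :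
    attenuate a v (Ω.indicator 1) x ≤ 1 - Real.exp (-a * D) := by
  rw [← integral_attKernel_Ioc hD0, attenuate, freq]
  have hm : Measurable (Ω.indicator (1 : E3 → ℝ)) := measurable_one.indicator hΩ
  have hb : ∀ z, |Ω.indicator (1 : E3 → ℝ) z| ≤ 1 := fun z => by
    by_cases hz : z ∈ Ω <;> simp [hz]
  have hI : Ioi (0 : ℝ) ∩ Ioc 0 D = Ioc 0 D := inter_eq_right.2 fun t ht => ht.1
  rw [← hI, ← setIntegral_indicator measurableSet_Ioc]
  refine setIntegral_mono_on (integrable_attenuate ha hm hb x)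
    ((integrable_attKernel ha).indicator measurableSet_Ioc) measurableSet_Ioi fun τ hτ => ?_
  by_cases hz : x - τ • v ∈ Ω
  · have : τ ≤ D := by
      have := hD _ hx _ hz
      rwa [sub_sub_cancel, norm_smul, hv, mul_one, Real.norm_of_nonneg (mem_Ioi.1 hτ).le] at this
    rw [indicator_of_mem (show τ ∈ Ioc 0 D from ⟨hτ, this⟩)]
    simp [hz]
  · rw [indicator_of_notMem hz, mul_zero]
    exact indicator_nonneg (fun τ _ => attKernel_nonneg ha τ) τ

instance : SigmaFinite freq := inferInstanceAs (SigmaFinite (volume.restrict (Ioi 0)))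

lemma measurable_attenuate {P : Type*} [MeasurableSpace P] {A : P → ℝ} {V : P → E3}
    {S : P → E3 → ℝ} {X : P → E3} (hA : Measurable A) (hV : Measurable V)
    (hS : Measurable (Function.uncurry S)) (hX : Measurable X) :
    Measurable fun p => attenuate (A p) (V p) (S p) (X p) := by
  have h1 : Measurable fun q : P × ℝ =>
      attKernel (A q.1) q.2 * S q.1 (X q.1 - q.2 • V q.1) := by
    unfold attKernel
    have : Measurable fun q : P × ℝ => S q.1 (X q.1 - q.2 • V q.1) :=
      hS.comp (measurable_fst.prodMk (by fun_prop))
    fun_prop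
  exact (h1.stronglyMeasurable.integral_prod_right' (ν := freq)).measurable

/-- The shear `(x, τ) ↦ (x + τv, τ)`. -/
def shear (v : E3) : (E3 × ℝ) ≃ᵐ (E3 × ℝ) where
  toFun p := (p.1 + p.2 • v, p.2)
  invFun p := (p.1 - p.2 • v, p.2)
  left_inv p := by simp
  right_inv p := by simp
  measurable_toFun := by dsimp; fun_prop
  measurable_invFun := by dsimp; fun_prop

lemma measurePreserving_shear (v : E3) :
    MeasurePreserving (shear v) ((volume : Measure E3).prod freq)
      ((volume : Measure E3).prod freq) := by
  have h1 : MeasurePreserving (fun p : ℝ × E3 => (p.1, p.2 + p.1 • v))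
      (freq.prod (volume : Measure E3)) (freq.prod (volume : Measure E3)) :=
    (MeasurePreserving.id freq).skew_product (g := fun τ x => x + τ • v) (by fun_prop)
      (ae_of_all _ fun τ => (measurePreserving_add_right volume (τ • v)).map_eq)
  exact (Measure.measurePreserving_swap.comp h1).comp Measure.measurePreserving_swap

lemma integrable_attenuate_of_integrable (ha : 0 ≤ a) {ψ : E3 → ℝ} (hψ : Integrable ψ) :
    Integrable (attenuate a v ψ) := by
  have h1 : Integrable (fun p : E3 × ℝ => ψ p.1 * attKernel a p.2)
      ((volume : Measure E3).prod freq) := hψ.mul_prod (integrable_attKernel ha)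
  have h2 := ((measurePreserving_shear (-v)).integrable_comp_emb
    (shear (-v)).measurableEmbedding).2 h1
  refine h2.integral_prod_left.congr (ae_of_all _ fun x => ?_)
  simp [attenuate, shear, mul_comm, sub_eq_add_neg]

/-- Reversing the rays gives the adjoint of attenuated averaging. -/
lemma integral_attenuate_mul (ha : 0 ≤ a) (hs : Measurable s) (hC : ∀ z, |s z| ≤ C) {ψ : E3 → ℝ}
    (hψ : Integrable ψ) :
    ∫ x, attenuate a v s x * ψ x = ∫ z, s z * attenuate a (-v) ψ z := by
  have hF : Integrable (fun p : E3 × ℝ => attKernel a p.2 * s (p.1 - p.2 • v) * ψ p.1)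
      ((volume : Measure E3).prod freq) := by
    have h1 : Integrable (fun p : E3 × ℝ => ψ p.1 * attKernel a p.2)
        ((volume : Measure E3).prod freq) := hψ.mul_prod (integrable_attKernel ha)
    have h2 : Measurable fun p : E3 × ℝ => s (p.1 - p.2 • v) := by fun_prop
    refine (h1.bdd_mul (c := C) h2.aestronglyMeasurable (ae_of_all _ fun p => hC _)).congr
      (ae_of_all _ fun p => ?_)
    dsimp only; ring
  have hF' := ((measurePreserving_shear v).integrable_comp_emb
    (shear v).measurableEmbedding).2 hF
  calc ∫ x, attenuate a v s x * ψ x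
      = ∫ x, ∫ τ, attKernel a τ * s (x - τ • v) * ψ x ∂freq := by
        simp only [attenuate, integral_mul_const]
    _ = ∫ p : E3 × ℝ, attKernel a p.2 * s (p.1 - p.2 • v) * ψ p.1
          ∂((volume : Measure E3).prod freq) := (integral_prod _ hF).symm
    _ = ∫ p, (fun p : E3 × ℝ => attKernel a p.2 * s (p.1 - p.2 • v) * ψ p.1) (shear v p)
          ∂((volume : Measure E3).prod freq) :=
        ((measurePreserving_shear v).integral_comp' _).symm
    _ = ∫ z, ∫ τ, attKernel a τ * s z * ψ (z + τ • v) ∂freq := by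
        refine (integral_prod _ hF').trans ?_
        simp [shear]
    _ = ∫ z, s z * attenuate a (-v) ψ z := by
        simp only [attenuate, ← integral_const_mul, smul_neg, sub_neg_eq_add]
        refine integral_congr_ae (ae_of_all _ fun z => integral_congr_ae (ae_of_all _ fun τ => ?_))
        dsimp only; ring

lemma inner_gradient (φ : E3 → ℝ) (x : E3) : inner ℝ v (gradient φ x) = fderiv ℝ φ x v := by
  rw [real_inner_comm, gradient, InnerProductSpace.toDual_symm_apply]

lemma continuous_inner_gradient {φ : E3 → ℝ} (hφ : ContDiff ℝ ∞ φ) :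
    Continuous fun x => inner ℝ v (gradient φ x) := by
  simp only [inner_gradient]
  exact (hφ.continuous_fderiv (by simp)).clm_apply continuous_const

lemma hasCompactSupport_inner_gradient {φ : E3 → ℝ} (hc : HasCompactSupport φ) :
    HasCompactSupport fun x => inner ℝ v (gradient φ x) := by
  simp only [inner_gradient]
  exact hc.fderiv_apply ℝ v

/-- The attenuated average along the reversed ray of a derivative along that ray. -/
lemma attenuate_neg_inner_gradient (ha : 0 ≤ a) {φ : E3 → ℝ} (hφ : ContDiff ℝ ∞ φ)
    (hc : HasCompactSupport φ) (z : E3) :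
    attenuate a (-v) (fun x => inner ℝ v (gradient φ x)) z
      = a * (attenuate a (-v) φ z - φ z) := by
  obtain ⟨C, hC⟩ := hc.exists_bound_of_continuous hφ.continuous
  obtain ⟨C', hC'⟩ := (hasCompactSupport_inner_gradient (v := v) hc).exists_bound_of_continuous
    (continuous_inner_gradient hφ)
  have i₁ : Integrable (fun τ => attKernel a τ * φ (z - τ • -v)) freq :=
    integrable_attenuate ha hφ.continuous.measurable hC z
  have i₂ : Integrable (fun τ => attKernel a τ * inner ℝ v (gradient φ (z - τ • -v))) freq :=
    integrable_attenuate ha (continuous_inner_gradient hφ).measurable hC' z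
  have hd : ∀ τ ∈ Ici (0 : ℝ), HasDerivAt (fun τ => attKernel a τ * φ (z - τ • -v))
      (attKernel a τ * inner ℝ v (gradient φ (z - τ • -v))
        - a * (attKernel a τ * φ (z - τ • -v))) τ := by
    intro τ _
    have h1 : HasDerivAt (attKernel a) (-a * attKernel a τ) τ :=
      ((hasDerivAt_exp_neg_mul a τ).const_mul (-a)).congr_of_eventuallyEq
        (Eventually.of_forall fun t => by simp [attKernel])
    have h2 : HasDerivAt (fun τ : ℝ => z - τ • -v) v τ :=
      (((hasDerivAt_id τ).smul_const (-v)).const_sub z).congr_deriv (by simp)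
    have h3 : HasFDerivAt φ (fderiv ℝ φ (z - τ • -v)) (z - τ • -v) :=
      ((hφ.differentiable (by simp)) _).hasFDerivAt
    refine (h1.mul (h3.comp_hasDerivAt τ h2)).congr_deriv ?_
    rw [inner_gradient, Function.comp_apply]
    ring
  have hlim : Tendsto (fun τ => attKernel a τ * φ (z - τ • -v)) atTop (𝓝 0) := by
    have hk : Tendsto (attKernel a) atTop (𝓝 0) := by
      rcases ha.eq_or_lt with rfl | ha
      · have : attKernel 0 = fun _ => 0 := by ext; simp [attKernel]
        simp [this]
      · have := (Real.tendsto_exp_neg_atTop_nhds_zero.comp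
          (tendsto_id.const_mul_atTop ha)).const_mul a
        have h0 : attKernel a = fun x => a * Real.exp (-(a * x)) := by ext; simp [attKernel]
        simpa [h0, Function.comp_def] using this
    exact hk.zero_mul_isBoundedUnder_le
      (isBoundedUnder_of ⟨C, fun τ => hC _⟩)
  have key := integral_Ioi_of_hasDerivAt_of_tendsto' hd (i₂.sub (i₁.const_mul a)) hlim
  have h0 : attKernel a 0 = a := by simp [attKernel]
  rw [← freq, integral_sub i₂ (i₁.const_mul a), integral_const_mul, h0, zero_smul, sub_zero] at key
  simp only [attenuate, freq] at key ⊢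
  linarith

lemma integral_inner_gradient_eq_zero {φ : E3 → ℝ} (hφ : ContDiff ℝ ∞ φ)
    (hc : HasCompactSupport φ) : ∫ x, inner ℝ v (gradient φ x) = 0 := by
  have h1 := (continuous_inner_gradient (v := v) hφ).integrable_of_hasCompactSupport
    (hasCompactSupport_inner_gradient hc) (μ := volume)
  simp only [inner_gradient] at h1 ⊢
  have := integral_mul_fderiv_eq_neg_fderiv_mul_of_integrable (μ := (volume : Measure E3))
    (f := fun _ => (1 : ℝ)) (g := φ) (v := v) (by simp) (by simpa using h1)
    (by simpa using hφ.continuous.integrable_of_hasCompactSupport hc) (by simp)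
    (fun x _ => (hφ.differentiable (by simp)) x)
  simpa using this

/-- The weak form of `v · ∇J = a (s - J)` for the attenuated average `J` of `s`. -/
lemma integral_attenuate_mul_inner_gradient (ha : 0 ≤ a) (hs : Measurable s)
    (hC : ∀ z, |s z| ≤ C) {φ : E3 → ℝ} (hφ : ContDiff ℝ ∞ φ) (hc : HasCompactSupport φ) :
    ∫ x, attenuate a v s x * inner ℝ v (gradient φ x)
      = a * ∫ x, (attenuate a v s x - s x) * φ x := by
  have hφi : Integrable φ := hφ.continuous.integrable_of_hasCompactSupport hc
  have hC0 : 0 ≤ C := (abs_nonneg _).trans (hC 0)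
  have hm : Measurable fun x => attenuate a v s x :=
    measurable_attenuate (P := E3) measurable_const measurable_const
      (hs.comp measurable_snd) measurable_id
  obtain ⟨C', hC'⟩ := hc.exists_bound_of_continuous hφ.continuous
  have hm' : Measurable fun x => attenuate a (-v) φ x :=
    measurable_attenuate (P := E3) measurable_const measurable_const
      (hφ.continuous.measurable.comp measurable_snd) measurable_id
  have i₁ : Integrable fun x => attenuate a v s x * φ x :=
    hφi.bdd_mul (c := C) hm.aestronglyMeasurable
      (ae_of_all _ fun x => abs_attenuate_le ha hs hC hC0 x)
  have i₂ : Integrable fun x => s x * φ x :=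
    hφi.bdd_mul (c := C) hs.aestronglyMeasurable (ae_of_all _ hC)
  rw [integral_attenuate_mul ha hs hC
    ((continuous_inner_gradient hφ).integrable_of_hasCompactSupport
      (hasCompactSupport_inner_gradient hc))]
  simp only [attenuate_neg_inner_gradient ha hφ hc, sub_mul]
  rw [integral_sub i₁ i₂, integral_attenuate_mul ha hs hC hφi]
  have i₃ : Integrable fun z => s z * attenuate a (-v) φ z :=
    (integrable_attenuate_of_integrable ha hφi).bdd_mul (c := C) hs.aestronglyMeasurable
      (ae_of_all _ hC)
  rw [← integral_sub i₃ i₂, ← integral_const_mul]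
  refine integral_congr_ae (ae_of_all _ fun z => ?_)
  dsimp only; ring

end Attenuation

/-! ### Rays in a convex domain -/

section Rays

variable {Ω : Set E3}

lemma norm_coe_sphere (n : S2) : ‖(n : E3)‖ = 1 := by simp

lemma exists_norm_sub_le (hΩb : Bornology.IsBounded Ω) :
    ∃ D : ℝ, 0 ≤ D ∧ ∀ x ∈ Ω, ∀ y ∈ Ω, ‖x - y‖ ≤ D := by
  refine ⟨Metric.diam Ω, Metric.diam_nonneg, fun x hx y hy => ?_⟩
  rw [← dist_eq_norm]
  exact Metric.dist_le_diam_of_mem hΩb hx hy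

lemma sub_smul_mem_iff_lt_exitTime (hΩo : IsOpen Ω) (hΩb : Bornology.IsBounded Ω)
    (hΩc : Convex ℝ Ω) {x : E3} (hx : x ∈ Ω) (n : S2) {t : ℝ} (ht : 0 ≤ t) :
    x - t • (n : E3) ∈ Ω ↔ t < exitTime Ω x n := by
  obtain ⟨D, hD0, hD⟩ := exists_norm_sub_le hΩb
  have hbdd : BddAbove {t : ℝ | 0 ≤ t ∧ x - t • (n : E3) ∈ Ω} := by
    refine ⟨D, fun t ht => ?_⟩
    have := hD _ hx _ ht.2
    rwa [sub_sub_cancel, norm_smul, norm_coe_sphere, mul_one, Real.norm_of_nonneg ht.1] at this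
  constructor
  · intro h
    have hc : Continuous fun t : ℝ => x - t • (n : E3) := by fun_prop
    have h1 : ∀ᶠ t' in 𝓝[>] t, x - t' • (n : E3) ∈ Ω :=
      nhdsWithin_le_nhds (hc.continuousAt.eventually (hΩo.mem_nhds h))
    obtain ⟨t', h', htt'⟩ := (h1.and self_mem_nhdsWithin).exists
    exact (mem_Ioi.1 htt').trans_le (le_csSup hbdd ⟨ht.trans (mem_Ioi.1 htt').le, h'⟩)
  · intro h
    obtain ⟨t', ⟨ht'0, ht'⟩, htt'⟩ := exists_lt_of_lt_csSup
      (s := {t : ℝ | 0 ≤ t ∧ x - t • (n : E3) ∈ Ω}) ⟨0, le_rfl, by simpa using hx⟩ h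
    have hpos : 0 < t' := ht.trans_lt htt'
    have := hΩc.add_smul_sub_mem hx ht' (t := t / t')
      (mem_Icc.2 ⟨by positivity, (div_le_one hpos).2 htt'.le⟩)
    convert this using 1
    rw [sub_sub_cancel_left, smul_neg, smul_smul, div_mul_cancel₀ _ hpos.ne', sub_eq_add_neg]

lemma exitTime_pos (hΩo : IsOpen Ω) (hΩb : Bornology.IsBounded Ω)
    (hΩc : Convex ℝ Ω) {x : E3} (hx : x ∈ Ω) (n : S2) : 0 < exitTime Ω x n :=
  (sub_smul_mem_iff_lt_exitTime hΩo hΩb hΩc hx n le_rfl).1 (by simpa using hx)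

lemma entryPoint_add_smul (x : E3) (n : S2) (t : ℝ) :
    entryPoint Ω x n + t • (n : E3) = x - (exitTime Ω x n - t) • (n : E3) := by
  rw [entryPoint]; module

lemma entryPoint_add_exitTime_smul (x : E3) (n : S2) :
    entryPoint Ω x n + exitTime Ω x n • (n : E3) = x := by
  simp [entryPoint]

lemma entryPoint_add_smul_mem_iff (hΩo : IsOpen Ω) (hΩb : Bornology.IsBounded Ω)
    (hΩc : Convex ℝ Ω) {x : E3} (hx : x ∈ Ω) (n : S2) {t : ℝ} (ht : t ≤ exitTime Ω x n) :
    entryPoint Ω x n + t • (n : E3) ∈ Ω ↔ 0 < t := by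
  rw [entryPoint_add_smul, sub_smul_mem_iff_lt_exitTime hΩo hΩb hΩc hx n (by linarith)]
  constructor <;> intro h <;> linarith

lemma entryPoint_mem_frontier (hΩo : IsOpen Ω) (hΩb : Bornology.IsBounded Ω)
    (hΩc : Convex ℝ Ω) {x : E3} (hx : x ∈ Ω) (n : S2) : entryPoint Ω x n ∈ frontier Ω := by
  have hs := exitTime_pos hΩo hΩb hΩc hx n
  rw [hΩo.frontier_eq]
  constructor
  · have hc : Continuous fun t : ℝ => entryPoint Ω x n + t • (n : E3) := by fun_prop
    have h1 : Tendsto (fun t : ℝ => entryPoint Ω x n + t • (n : E3)) (𝓝[>] 0)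
        (𝓝 (entryPoint Ω x n)) := by
      simpa using (hc.tendsto 0).mono_left nhdsWithin_le_nhds
    refine mem_closure_of_tendsto h1 ?_
    filter_upwards [self_mem_nhdsWithin, nhdsWithin_le_nhds (gt_mem_nhds hs)] with t ht hts
    exact (entryPoint_add_smul_mem_iff hΩo hΩb hΩc hx n hts.le).2 ht
  · have := entryPoint_add_smul_mem_iff hΩo hΩb hΩc hx n hs.le
    simpa using this

/-- A convex open set lies strictly on the inner side of each of its tangent planes. -/
lemma inner_sub_outwardNormal_neg (hΩo : IsOpen Ω) (hΩc : Convex ℝ Ω) {x y N : E3} (hx : x ∈ Ω)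
    (hy : y ∈ frontier Ω) (hN : HasOutwardNormal Ω y N) : inner ℝ (x - y) N < 0 := by
  obtain ⟨hN1, ρ, hρ, hρ0, ⟨r, hr, hgrad⟩, hΩρ⟩ := hN
  -- The point `x` can be moved a little in the direction `N` without leaving `Ω`.
  have hc : Continuous fun ε : ℝ => x + ε • N := by fun_prop
  have h1 : ∀ᶠ ε in 𝓝[>] (0 : ℝ), x + ε • N ∈ Ω :=
    nhdsWithin_le_nhds (hc.continuousAt.eventually (hΩo.mem_nhds (by simpa using hx)))
  obtain ⟨ε, hε, hε0⟩ := (h1.and self_mem_nhdsWithin).exists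
  set w := x + ε • N - y with hw
  have hmem : ∀ t ∈ Ioc (0 : ℝ) 1, y + t • w ∈ Ω := by
    intro t ht
    have := hΩc.add_smul_sub_mem_interior' (x := y) (y := x + ε • N) (frontier_subset_closure hy)
      (by rwa [hΩo.interior_eq]) ht
    rwa [hΩo.interior_eq] at this
  have hd : HasDerivAt (fun t : ℝ => ρ (y + t • w)) (r * inner ℝ N w) 0 := by
    have h2 : HasDerivAt (fun t : ℝ => y + t • w) w 0 :=
      (((hasDerivAt_id (0 : ℝ)).smul_const w).const_add y).congr_deriv (by simp)
    have h3 : HasFDerivAt ρ (fderiv ℝ ρ y) (y + (0 : ℝ) • w) := by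
      simpa using (hρ.differentiableAt (by simp)).hasFDerivAt
    refine (h3.comp_hasDerivAt (0 : ℝ) h2).congr_deriv ?_
    rw [← inner_gradient, hgrad, inner_smul_right, real_inner_comm]
  have hle : r * inner ℝ N w ≤ 0 := by
    refine le_of_tendsto hd.tendsto_slope_zero_right ?_
    have hc : Continuous fun t : ℝ => y + t • w := by fun_prop
    have h4 : ∀ᶠ t in 𝓝[>] (0 : ℝ), (y + t • w ∈ Ω ↔ ρ (y + t • w) < 0) := by
      have : Tendsto (fun t : ℝ => y + t • w) (𝓝[>] 0) (𝓝 y) := by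
        simpa using (hc.tendsto 0).mono_left nhdsWithin_le_nhds
      exact this.eventually hΩρ
    filter_upwards [h4, self_mem_nhdsWithin, nhdsWithin_le_nhds (gt_mem_nhds (zero_lt_one' ℝ))]
      with t h5 ht0 ht1
    have := h5.1 (hmem t ⟨ht0, ht1.le⟩)
    simp only [zero_add, zero_smul, add_zero, hρ0, sub_zero, smul_eq_mul]
    exact mul_nonpos_of_nonneg_of_nonpos (inv_nonneg.2 (mem_Ioi.1 ht0).le) this.le
  have h6 : inner ℝ N w = inner ℝ (x - y) N + ε := by
    rw [hw, show x + ε • N - y = (x - y) + ε • N by abel, inner_add_right, inner_smul_right,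
      real_inner_self_eq_norm_sq, hN1, real_inner_comm]
    ring
  have h7 := nonpos_of_mul_nonpos_right hle hr
  have : 0 < ε := hε0
  linarith

lemma inner_outwardNormal_entryPoint_neg (hΩo : IsOpen Ω) (hΩb : Bornology.IsBounded Ω)
    (hΩc : Convex ℝ Ω) {x : E3} (hx : x ∈ Ω) (n : S2) {N : E3}
    (hN : HasOutwardNormal Ω (entryPoint Ω x n) N) : inner ℝ (n : E3) N < 0 := by
  have h := inner_sub_outwardNormal_neg hΩo hΩc hx (entryPoint_mem_frontier hΩo hΩb hΩc hx n) hN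
  rw [entryPoint, sub_sub_cancel, real_inner_smul_left] at h
  exact neg_of_mul_neg_right h (exitTime_pos hΩo hΩb hΩc hx n).le

lemma sub_smul_notMem_of_inner_neg (hΩo : IsOpen Ω) (hΩc : Convex ℝ Ω) {x N v : E3}
    (hx : x ∈ frontier Ω) (hN : HasOutwardNormal Ω x N) (hv : inner ℝ v N < 0) {t : ℝ}
    (ht : 0 < t) : x - t • v ∉ Ω := by
  intro h
  have := inner_sub_outwardNormal_neg hΩo hΩc h hx hN
  rw [sub_sub_cancel_left, inner_neg_left, real_inner_smul_left] at this
  nlinarith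

instance : IsFiniteMeasure surf := by unfold surf; infer_instance

/-- Almost every ray meets a null set in a null set of times. -/
lemma ae_ae_add_smul_notMem {s : Set E3} (hs : volume s = 0) :
    ∀ᵐ p ∂((volume : Measure E3).prod surf), ∀ᵐ t : ℝ, p.1 + t • (p.2 : E3) ∉ s := by
  obtain ⟨u, hsu, hum, hu⟩ := exists_measurable_superset_of_null hs
  have h1 : ∀ᵐ q ∂((surf.prod (volume : Measure ℝ)).prod (volume : Measure E3)),
      q.2 + q.1.2 • (q.1.1 : E3) ∉ u := by
    have hm : Measurable fun q : (S2 × ℝ) × E3 => q.2 + q.1.2 • (q.1.1 : E3) := by fun_prop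
    rw [Measure.ae_prod_iff_ae_ae]
    · refine ae_of_all _ fun q => ?_
      have := (measurePreserving_add_right (volume : Measure E3)
        (q.2 • (q.1 : E3))).quasiMeasurePreserving.ae (measure_eq_zero_iff_ae_notMem.1 hu)
      exact this
    · exact (hm hum).compl
  have h2 : MeasurePreserving (fun q : (E3 × S2) × ℝ => ((q.1.2, q.2), q.1.1))
      (((volume : Measure E3).prod surf).prod (volume : Measure ℝ))
      ((surf.prod (volume : Measure ℝ)).prod (volume : Measure E3)) :=
    Measure.measurePreserving_swap.comp (measurePreserving_prodAssoc _ _ _)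
  have h3 := Measure.ae_ae_of_ae_prod (h2.quasiMeasurePreserving.ae h1)
  filter_upwards [h3] with p hp
  filter_upwards [hp] with t ht using fun h => ht (hsu h)

lemma ae_ae_entryPoint_add_smul_notMem {s : Set E3} (hs : volume s = 0) :
    ∀ᵐ p ∂((volume : Measure E3).prod surf),
      ∀ᵐ t : ℝ, entryPoint Ω p.1 p.2 + t • (p.2 : E3) ∉ s := by
  filter_upwards [ae_ae_add_smul_notMem hs] with p hp
  have := (measurePreserving_sub_right (volume : Measure ℝ)
    (exitTime Ω p.1 p.2)).quasiMeasurePreserving.ae hp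
  filter_upwards [this] with t ht
  rw [entryPoint_add_smul]
  convert ht using 2
  module

end Rays

/-! ### The transfer equation along a ray -/

section RayEquation

lemma AbsolutelyContinuousOnInterval.congr_uIcc {f₁ f₂ : ℝ → ℝ} {p q : ℝ}
    (hf : AbsolutelyContinuousOnInterval f₁ p q) (h : ∀ t ∈ uIcc p q, f₁ t = f₂ t) :
    AbsolutelyContinuousOnInterval f₂ p q := by
  rw [absolutelyContinuousOnInterval_iff] at hf ⊢
  intro ε hε
  obtain ⟨δ, hδ, H⟩ := hf ε hε
  refine ⟨δ, hδ, fun E hE hEδ => ?_⟩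
  refine lt_of_eq_of_lt (Finset.sum_congr rfl fun i hi => ?_) (H E hE hEδ)
  rw [h _ (hE.1 i hi).1, h _ (hE.1 i hi).2]

/-- Duhamel's formula `G + a e^{-at} ∫₀ᵗ e^{ar} (b(r) - G) dr` for the solution of
`u' = a (b - u)`, `u(0) = G`. -/
def duhamel (a G : ℝ) (b : ℝ → ℝ) (t : ℝ) : ℝ :=
  G + a * Real.exp (-a * t) * ∫ r in 0..t, Real.exp (a * r) * (b r - G)

variable {a G C s : ℝ} {b : ℝ → ℝ}

@[simp] lemma duhamel_zero : duhamel a G b 0 = G := by simp [duhamel]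

lemma intervalIntegrable_duhamel (hb : Measurable b) (hC : ∀ r, |b r| ≤ C) (p q : ℝ) :
    IntervalIntegrable (fun r => Real.exp (a * r) * (b r - G)) volume p q := by
  have h1 : IntervalIntegrable (fun r => b r - G) volume p q := by
    refine IntervalIntegrable.mono_fun (g := fun r => b r - G) (f := fun _ => C + |G|)
      intervalIntegrable_const (hb.sub_const G).aestronglyMeasurable (ae_of_all _ fun r => ?_)
    have := (abs_sub (b r) G).trans (add_le_add_left (hC r) |G|)
    exact this.trans (le_abs_self _)
  exact h1.continuousOn_mul (by fun_prop)

lemma absolutelyContinuousOnInterval_exp (a p q : ℝ) :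
    AbsolutelyContinuousOnInterval (fun t => Real.exp (a * t)) p q :=
  ContDiffOn.absolutelyContinuousOnInterval
    (ContDiff.contDiffOn (by fun_prop : ContDiff ℝ 1 fun t => Real.exp (a * t)))

lemma absolutelyContinuousOnInterval_const (r p q : ℝ) :
    AbsolutelyContinuousOnInterval (fun _ => r) p q :=
  ContDiffOn.absolutelyContinuousOnInterval contDiffOn_const

lemma absolutelyContinuousOnInterval_duhamel (hb : Measurable b) (hC : ∀ r, |b r| ≤ C) :
    AbsolutelyContinuousOnInterval (duhamel a G b) 0 s :=
  (absolutelyContinuousOnInterval_const G 0 s).add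
    (((absolutelyContinuousOnInterval_exp (-a) 0 s).const_mul a).mul
      ((intervalIntegrable_duhamel hb hC 0 s).absolutelyContinuousOnInterval_intervalIntegral
        left_mem_uIcc))

lemma ae_hasDerivAt_duhamel (hb : Measurable b) (hC : ∀ r, |b r| ≤ C) :
    ∀ᵐ t : ℝ, t ∈ Ioo 0 s → HasDerivAt (duhamel a G b) (a * (b t - duhamel a G b t)) t := by
  filter_upwards [(intervalIntegrable_duhamel (a := a) (G := G) hb hC 0 s).ae_hasDerivAt_integral]
    with t ht hts
  have h1 := ht (Ioo_subset_Icc_self.trans Icc_subset_uIcc hts) 0 left_mem_uIcc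
  have h2 : HasDerivAt (fun t => a * Real.exp (-a * t)) (a * (Real.exp (-a * t) * (-a))) t := by
    simpa using (((hasDerivAt_id t).const_mul (-a)).exp).const_mul a
  refine ((h2.mul h1).const_add G).congr_deriv ?_
  have h3 : Real.exp (-a * t) * Real.exp (a * t) = 1 := by rw [← Real.exp_add]; simp
  rw [duhamel]
  linear_combination a * (b t - G) * h3

/-- Absolutely continuous solutions of `u' = a (b - u)`, `u(0) = G` are unique. -/
lemma eq_duhamel (hs : 0 ≤ s) (hb : Measurable b) (hC : ∀ r, |b r| ≤ C) {u b' : ℝ → ℝ}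
    (hu : AbsolutelyContinuousOnInterval u 0 s) (hu0 : u 0 = G)
    (hu' : ∀ᵐ t : ℝ, t ∈ Ioo 0 s → HasDerivAt u (a * (b' t - u t)) t)
    (hbb' : ∀ᵐ t : ℝ, t ∈ Ioo 0 s → b' t = b t) : u s = duhamel a G b s := by
  have hac : AbsolutelyContinuousOnInterval
      (fun t => Real.exp (a * t) * (u t - duhamel a G b t)) 0 s :=
    (absolutelyContinuousOnInterval_exp a 0 s).mul
      (hu.sub (absolutelyContinuousOnInterval_duhamel hb hC))
  have h0 : ∀ᵐ t : ℝ, t ≠ 0 := by simp [ae_iff, measure_singleton]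
  have h1 : ∀ᵐ t : ℝ, t ≠ s := by simp [ae_iff, measure_singleton]
  obtain ⟨K, hK⟩ := hac.const_of_ae_hasDerivAt_zero (by
    filter_upwards [hu', hbb', ae_hasDerivAt_duhamel (a := a) (G := G) (s := s) hb hC, h0, h1]
      with t d₁ e d₂ n0 n1 hts
    rw [uIcc_of_le hs] at hts
    have hts : t ∈ Ioo 0 s := ⟨hts.1.lt_of_ne n0.symm, hts.2.lt_of_ne n1⟩
    have h2 : HasDerivAt (fun t => Real.exp (a * t)) (Real.exp (a * t) * a) t := by
      simpa using ((hasDerivAt_id t).const_mul a).exp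
    refine (h2.mul ((d₁ hts).sub (d₂ hts))).congr_deriv ?_
    rw [e hts]
    simp only [Pi.sub_apply]
    ring)
  have e0 := hK 0 left_mem_uIcc
  have es := hK s right_mem_uIcc
  rw [← e0, hu0, duhamel_zero, sub_self, mul_zero] at es
  exact sub_eq_zero.1 ((mul_eq_zero.1 es).resolve_left (Real.exp_pos _).ne')

end RayEquation

section RayIntensity

/-- The intensity at `x` in direction `v` for absorption coefficient `a`, incoming intensity `G` and
black-body emission `b`. Subtracting `G` from the source inside `Ω` accounts for the attenuation of
the incoming radiation, so that the exit time does not occur. -/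
def rayIntensity (Ω : Set E3) (a : ℝ) (v : E3) (G : ℝ) (b : E3 → ℝ) (x : E3) : ℝ :=
  G + attenuate a v (Ω.indicator fun z => b z - G) x

variable {Ω : Set E3} {a G C : ℝ} {b : E3 → ℝ}

lemma rayIntensity_of_forall_notMem {v x : E3} (h : ∀ t : ℝ, 0 < t → x - t • v ∉ Ω) :
    rayIntensity Ω a v G b x = G := by
  rw [rayIntensity, attenuate, freq,
    setIntegral_congr_fun (g := fun _ => (0 : ℝ)) measurableSet_Ioi]
  · simp
  · intro t ht
    simp [indicator_of_notMem (h t ht)]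

lemma rayIntensity_entryPoint_add_smul (hΩo : IsOpen Ω) (hΩb : Bornology.IsBounded Ω)
    (hΩc : Convex ℝ Ω) {x : E3} (hx : x ∈ Ω) (n : S2) {t : ℝ}
    (ht : t ∈ Icc 0 (exitTime Ω x n)) :
    rayIntensity Ω a n G b (entryPoint Ω x n + t • (n : E3))
      = duhamel a G (fun r => b (entryPoint Ω x n + r • (n : E3))) t := by
  rw [rayIntensity, duhamel, attenuate]
  congr 1
  set q : ℝ → ℝ := fun r => b (entryPoint Ω x n + r • (n : E3)) - G with hq
  have h1 : ∀ τ ∈ Ioi (0 : ℝ), attKernel a τ * Ω.indicator (fun z => b z - G)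
      (entryPoint Ω x n + t • (n : E3) - τ • (n : E3))
      = (Iio t).indicator (fun τ => attKernel a τ * q (t - τ)) τ := by
    intro τ hτ
    have e : entryPoint Ω x n + t • (n : E3) - τ • (n : E3)
        = entryPoint Ω x n + (t - τ) • (n : E3) := by module
    have hτ : 0 < τ := hτ
    have hiff := entryPoint_add_smul_mem_iff hΩo hΩb hΩc hx n (t := t - τ) (by linarith [ht.2])
    rw [e]
    by_cases hτt : τ < t
    · rw [indicator_of_mem (mem_Iio.2 hτt), indicator_of_mem (hiff.2 (by linarith))]
    · rw [indicator_of_notMem (s := Iio t) (by simpa using hτt),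
        indicator_of_notMem (fun h => hτt (by linarith [hiff.1 h])), mul_zero]
  rw [freq, setIntegral_congr_fun measurableSet_Ioi h1, setIntegral_indicator measurableSet_Iio,
    Ioi_inter_Iio, ← integral_Ioc_eq_integral_Ioo, ← intervalIntegral.integral_of_le ht.1]
  have h2 := intervalIntegral.integral_comp_sub_left (a := 0) (b := t)
    (fun r => attKernel a (t - r) * q r) t
  simp only [sub_sub_cancel, sub_self, sub_zero] at h2
  rw [h2, ← intervalIntegral.integral_const_mul]
  refine intervalIntegral.integral_congr fun r _ => ?_
  dsimp only [attKernel]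
  rw [show -a * (t - r) = -a * t + a * r by ring, Real.exp_add]
  ring

lemma measurable_comp_line (hb : Measurable b) (y v : E3) : Measurable fun r : ℝ => b (y + r • v) :=
  hb.comp (by fun_prop)

/-- The intensity solves the transfer equation along every ray. -/
lemma rayIntensity_transport (hΩo : IsOpen Ω) (hΩb : Bornology.IsBounded Ω)
    (hΩc : Convex ℝ Ω) (hb : Measurable b) (hC : ∀ z, |b z| ≤ C) {x : E3} (hx : x ∈ Ω) (n : S2) :
    AbsolutelyContinuousOnInterval
      (fun t : ℝ => rayIntensity Ω a n G b (entryPoint Ω x n + t • (n : E3))) 0 (exitTime Ω x n) ∧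
    ∀ᵐ t ∂(volume.restrict (Ioo 0 (exitTime Ω x n))),
      HasDerivAt (fun t : ℝ => rayIntensity Ω a n G b (entryPoint Ω x n + t • (n : E3)))
        (a * (b (entryPoint Ω x n + t • (n : E3))
          - rayIntensity Ω a n G b (entryPoint Ω x n + t • (n : E3)))) t := by
  have hs := exitTime_pos hΩo hΩb hΩc hx n
  have hm := measurable_comp_line hb (entryPoint Ω x n) n
  constructor
  · refine AbsolutelyContinuousOnInterval.congr_uIcc
      (absolutelyContinuousOnInterval_duhamel (a := a) (G := G) hm fun r => hC _) fun t ht => ?_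
    rw [uIcc_of_le hs.le] at ht
    exact (rayIntensity_entryPoint_add_smul hΩo hΩb hΩc hx n ht).symm
  · rw [ae_restrict_iff' measurableSet_Ioo]
    filter_upwards [ae_hasDerivAt_duhamel (a := a) (G := G) (s := exitTime Ω x n) hm fun r => hC _]
      with t ht hts
    rw [rayIntensity_entryPoint_add_smul hΩo hΩb hΩc hx n (Ioo_subset_Icc_self hts)]
    refine (ht hts).congr_of_eventuallyEq ?_
    filter_upwards [Ioo_mem_nhds hts.1 hts.2] with r hr
    exact rayIntensity_entryPoint_add_smul hΩo hΩb hΩc hx n (Ioo_subset_Icc_self hr)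

/-- A solution of the transfer equation along the ray through `x` has the intensity at `x`. -/
lemma eq_rayIntensity (hΩo : IsOpen Ω) (hΩb : Bornology.IsBounded Ω)
    (hΩc : Convex ℝ Ω) (hb : Measurable b) (hC : ∀ z, |b z| ≤ C) {x : E3} (hx : x ∈ Ω) (n : S2)
    {u b' : E3 → ℝ} (hu : AbsolutelyContinuousOnInterval
      (fun t : ℝ => u (entryPoint Ω x n + t • (n : E3))) 0 (exitTime Ω x n))
    (hu' : ∀ᵐ t ∂(volume.restrict (Ioo 0 (exitTime Ω x n))),
      HasDerivAt (fun t : ℝ => u (entryPoint Ω x n + t • (n : E3)))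
        (a * (b' (entryPoint Ω x n + t • (n : E3)) - u (entryPoint Ω x n + t • (n : E3)))) t)
    (hu0 : u (entryPoint Ω x n) = G)
    (hbb' : ∀ᵐ t : ℝ, entryPoint Ω x n + t • (n : E3) ∈ Ω →
      b' (entryPoint Ω x n + t • (n : E3)) = b (entryPoint Ω x n + t • (n : E3))) :
    u x = rayIntensity Ω a n G b x := by
  have hs := exitTime_pos hΩo hΩb hΩc hx n
  rw [ae_restrict_iff' measurableSet_Ioo] at hu'
  have h1 := eq_duhamel (b' := fun t => b' (entryPoint Ω x n + t • (n : E3))) hs.le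
    (measurable_comp_line hb (entryPoint Ω x n) n) (fun r => hC _) hu (by simpa using hu0) hu' (by
      filter_upwards [hbb'] with t ht hts
      exact ht ((entryPoint_add_smul_mem_iff hΩo hΩb hΩc hx n hts.2.le).2 hts.1))
  rw [← rayIntensity_entryPoint_add_smul hΩo hΩb hΩc hx n (right_mem_Icc.2 hs.le),
    entryPoint_add_exitTime_smul] at h1
  exact h1

end RayIntensity

/-! ### Bounds and the weak form of the transfer equation -/

section RayBounds

variable {Ω : Set E3} {a G B : ℝ} {v : E3} {b b₁ b₂ : E3 → ℝ}

lemma abs_indicator_le {B : ℝ} (hB : ∀ z, |b z| ≤ B) (z : E3) : |Ω.indicator b z| ≤ B := by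
  by_cases hz : z ∈ Ω
  · simpa [hz] using hB z
  · simpa [hz] using (abs_nonneg _).trans (hB z)

lemma rayIntensity_eq (hΩ : MeasurableSet Ω) (ha : 0 ≤ a) (hb : Measurable b)
    (hB : ∀ z, |b z| ≤ B) (x : E3) : rayIntensity Ω a v G b x
      = G * (1 - attenuate a v (Ω.indicator 1) x) + attenuate a v (Ω.indicator b) x := by
  have h1 : ∀ z, |Ω.indicator (1 : E3 → ℝ) z * G| ≤ |G| := fun z => by
    by_cases hz : z ∈ Ω <;> simp [hz]
  have h2 : (Ω.indicator fun z => b z - G)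
      = fun z => Ω.indicator b z - Ω.indicator (1 : E3 → ℝ) z * G := by
    ext z
    by_cases hz : z ∈ Ω <;> simp [hz]
  rw [rayIntensity, h2, attenuate_sub ha (hb.indicator hΩ) (abs_indicator_le hB)
    ((measurable_one.indicator hΩ).mul_const G) h1, attenuate_mul_const]
  ring

lemma attenuate_indicator_one_mem (hΩ : MeasurableSet Ω) (ha : 0 ≤ a) (x : E3) :
    attenuate a v (Ω.indicator 1) x ∈ Icc (0 : ℝ) 1 := by
  refine ⟨attenuate_nonneg ha (fun z => indicator_nonneg (fun _ _ => zero_le_one) z) x,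
    attenuate_le ha (measurable_one.indicator hΩ) (abs_indicator_le (b := 1) fun z => ?_)
      zero_le_one x⟩
  simp

lemma rayIntensity_nonneg (hΩ : MeasurableSet Ω) (ha : 0 ≤ a) (hG : 0 ≤ G) (hb : Measurable b)
    (hb0 : ∀ z, 0 ≤ b z) (hB : ∀ z, b z ≤ B) (x : E3) : 0 ≤ rayIntensity Ω a v G b x := by
  rw [rayIntensity_eq hΩ ha hb (fun z => (abs_of_nonneg (hb0 z)).trans_le (hB z))]
  have := (attenuate_indicator_one_mem (v := v) hΩ ha x).2
  exact add_nonneg (mul_nonneg hG (by linarith))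
    (attenuate_nonneg ha (fun z => indicator_nonneg (fun z _ => hb0 z) z) x)

lemma rayIntensity_le_add_attenuate (hΩ : MeasurableSet Ω) (ha : 0 ≤ a) (hG : 0 ≤ G)
    (hb : Measurable b) (hb0 : ∀ z, 0 ≤ b z) (hB : ∀ z, b z ≤ B) (x : E3) :
    rayIntensity Ω a v G b x ≤ G + attenuate a v (Ω.indicator 1) x * B := by
  have hB' : ∀ z, |b z| ≤ B := fun z => (abs_of_nonneg (hb0 z)).trans_le (hB z)
  rw [rayIntensity_eq hΩ ha hb hB']
  have h0 := (attenuate_indicator_one_mem (v := v) hΩ ha x).1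
  have h1 : attenuate a v (Ω.indicator b) x ≤ attenuate a v (Ω.indicator 1) x * B := by
    rw [← attenuate_mul_const]
    refine attenuate_mono ha (hb.indicator hΩ) (abs_indicator_le hB')
      ((measurable_one.indicator hΩ).mul_const B) (C' := |B|) (fun z => ?_) (fun z => ?_) x
    · by_cases hz : z ∈ Ω <;> simp [hz]
    · by_cases hz : z ∈ Ω <;> simp [hz, hB]
  nlinarith

lemma rayIntensity_le (hΩ : MeasurableSet Ω) (ha : 0 ≤ a) (hG : 0 ≤ G) (hb : Measurable b)
    (hb0 : ∀ z, 0 ≤ b z) (hB : ∀ z, b z ≤ B) (x : E3) :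
    rayIntensity Ω a v G b x ≤ G + B := by
  have hB0 : 0 ≤ B := (hb0 0).trans (hB 0)
  have := (attenuate_indicator_one_mem (v := v) hΩ ha x).2
  nlinarith [rayIntensity_le_add_attenuate (v := v) hΩ ha hG hb hb0 hB x]

/-- Inside `Ω`, some of the constant bound `B` on the black-body emission is lost through the
boundary. -/
lemma rayIntensity_le_sub_exp (hΩ : MeasurableSet Ω) (ha : 0 ≤ a) (hv : ‖v‖ = 1) (hG : 0 ≤ G)
    (hb : Measurable b) (hb0 : ∀ z, 0 ≤ b z) (hB : ∀ z, b z ≤ B) {D : ℝ} (hD0 : 0 ≤ D)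
    (hD : ∀ x ∈ Ω, ∀ y ∈ Ω, ‖x - y‖ ≤ D) {x : E3} (hx : x ∈ Ω) :
    rayIntensity Ω a v G b x ≤ G + (1 - Real.exp (-a * D)) * B := by
  have hB0 : 0 ≤ B := (hb0 0).trans (hB 0)
  have := attenuate_indicator_one_le hΩ ha hv hD0 hD hx
  nlinarith [rayIntensity_le_add_attenuate (v := v) hΩ ha hG hb hb0 hB x]

lemma rayIntensity_sub (hΩ : MeasurableSet Ω) (ha : 0 ≤ a) (hb₁ : Measurable b₁)
    (hB₁ : ∀ z, |b₁ z| ≤ B) (hb₂ : Measurable b₂) (hB₂ : ∀ z, |b₂ z| ≤ B) (x : E3) :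
    rayIntensity Ω a v G b₁ x - rayIntensity Ω a v G b₂ x
      = attenuate a v (Ω.indicator fun z => b₁ z - b₂ z) x := by
  rw [rayIntensity_eq hΩ ha hb₁ hB₁, rayIntensity_eq hΩ ha hb₂ hB₂, add_sub_add_left_eq_sub,
    ← attenuate_sub ha (hb₁.indicator hΩ) (abs_indicator_le hB₁) (hb₂.indicator hΩ)
      (abs_indicator_le hB₂)]
  congr 1
  ext z
  by_cases hz : z ∈ Ω <;> simp [hz]

lemma rayIntensity_mono (hΩ : MeasurableSet Ω) (ha : 0 ≤ a) (hb₁ : Measurable b₁)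
    (hB₁ : ∀ z, |b₁ z| ≤ B) (hb₂ : Measurable b₂) (hB₂ : ∀ z, |b₂ z| ≤ B)
    (h : ∀ z, b₁ z ≤ b₂ z) (x : E3) :
    rayIntensity Ω a v G b₁ x ≤ rayIntensity Ω a v G b₂ x := by
  rw [← sub_nonneg, rayIntensity_sub hΩ ha hb₂ hB₂ hb₁ hB₁]
  exact attenuate_nonneg ha (fun z => indicator_nonneg (fun z _ => sub_nonneg.2 (h z)) z) x

lemma setIntegral_mul_inner_gradient (F : E3 → ℝ) {φ : E3 → ℝ} (hsub : tsupport φ ⊆ Ω) :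
    ∫ x in Ω, F x * inner ℝ v (gradient φ x) = ∫ x, F x * inner ℝ v (gradient φ x) := by
  refine setIntegral_eq_integral_of_forall_compl_eq_zero fun x hx => ?_
  rw [inner_gradient, image_eq_zero_of_notMem_tsupport (f := fderiv ℝ φ)
    fun h => hx (hsub (tsupport_fderiv_subset ℝ h))]
  simp

/-- The weak form of `v · ∇I = a (b - I)`. -/
lemma integral_rayIntensity_mul_inner_gradient (hΩ : MeasurableSet Ω) (ha : 0 ≤ a)
    (hb : Measurable b) (hB : ∀ z, |b z| ≤ B) {φ : E3 → ℝ} (hφ : ContDiff ℝ ∞ φ)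
    (hc : HasCompactSupport φ) (hsub : tsupport φ ⊆ Ω) :
    ∫ x in Ω, rayIntensity Ω a v G b x * inner ℝ v (gradient φ x)
      = ∫ x in Ω, a * (rayIntensity Ω a v G b x - b x) * φ x := by
  set s := Ω.indicator fun z => b z - G with hs
  have hsm : Measurable s := (hb.sub_const G).indicator hΩ
  have hsC : ∀ z, |s z| ≤ B + |G| := abs_indicator_le fun z =>
    (abs_sub _ _).trans (add_le_add_left (hB z) _)
  have hC0 : 0 ≤ B + |G| := (abs_nonneg _).trans (hsC 0)
  have hm : Measurable fun x => attenuate a v s x :=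
    measurable_attenuate (P := E3) measurable_const measurable_const
      (hsm.comp measurable_snd) measurable_id
  have hgi : Integrable fun x => inner ℝ v (gradient φ x) :=
    (continuous_inner_gradient (v := v) hφ).integrable_of_hasCompactSupport
      (hasCompactSupport_inner_gradient hc)
  rw [setIntegral_mul_inner_gradient _ hsub]
  simp only [rayIntensity, add_mul]
  rw [integral_add (hgi.const_mul G) (hgi.bdd_mul hm.aestronglyMeasurable
    (ae_of_all _ fun x => abs_attenuate_le ha hsm hsC hC0 x)), integral_const_mul,
    integral_inner_gradient_eq_zero hφ hc, mul_zero, zero_add,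
    integral_attenuate_mul_inner_gradient ha hsm hsC hφ hc, ← integral_const_mul]
  symm
  rw [← integral_indicator hΩ]
  refine integral_congr_ae (ae_of_all _ fun x => ?_)
  by_cases hx : x ∈ Ω
  · simp [hs, hx]; ring
  · simp [hx, image_eq_zero_of_notMem_tsupport fun h => hx (hsub h)]

end RayBounds

/-! ### Energy balance -/

section Flux

/-- The measure on pairs of a frequency and a direction. -/
def rays : Measure (ℝ × S2) := freq.prod surf

instance : SFinite rays := by unfold rays; infer_instance

lemma ae_rays_pos : ∀ᵐ p ∂rays, 0 < p.1 := Measure.quasiMeasurePreserving_fst.ae ae_freq_pos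

lemma measurePreserving_rays (Ω : Set E3) :
    MeasurePreserving (fun q : ℝ × E3 × S2 => ((q.1, q.2.2), q.2.1))
      (freq.prod ((volume.restrict Ω).prod surf)) (rays.prod (volume.restrict Ω)) :=
  ((measurePreserving_prodAssoc freq surf (volume.restrict Ω)).symm _).comp
    ((MeasurePreserving.id freq).prod Measure.measurePreserving_swap)

lemma measurePreserving_rays_symm (Ω : Set E3) :
    MeasurePreserving (fun q : (ℝ × S2) × E3 => (q.1.1, q.2, q.1.2))
      (rays.prod (volume.restrict Ω)) (freq.prod ((volume.restrict Ω).prod surf)) :=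
  ((MeasurePreserving.id freq).prod Measure.measurePreserving_swap).comp
    (measurePreserving_prodAssoc freq surf (volume.restrict Ω))

variable {Ω : Set E3}

lemma ae_flux_eq {J : ℝ → E3 → S2 → ℝ}
    (hJ : Integrable (fun q : (ℝ × S2) × E3 => J q.1.1 q.2 q.1.2)
      (rays.prod (volume.restrict Ω))) :
    ∀ᵐ x ∂(volume.restrict Ω), Integrable (fun p : ℝ × S2 => J p.1 x p.2 • (p.2 : E3)) rays ∧
      flux J x = ∫ p, J p.1 x p.2 • (p.2 : E3) ∂rays := by
  filter_upwards [hJ.prod_left_ae] with x hx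
  have h1 : Integrable (fun p : ℝ × S2 => J p.1 x p.2 • (p.2 : E3)) rays :=
    hx.norm.mono' (hx.aestronglyMeasurable.smul
      (Measurable.aestronglyMeasurable (by fun_prop))) (ae_of_all _ fun p => by
        rw [norm_smul, norm_coe_sphere, mul_one])
  exact ⟨h1, (integral_prod _ h1).symm⟩

lemma flux_congr_ae {J₁ J₂ : ℝ → E3 → S2 → ℝ}
    (h : ∀ᵐ q ∂(rays.prod (volume.restrict Ω)), J₁ q.1.1 q.2 q.1.2 = J₂ q.1.1 q.2 q.1.2) :
    ∀ᵐ x ∂(volume.restrict Ω), flux J₁ x = flux J₂ x := by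
  have h1 := Measure.ae_ae_of_ae_prod (Measure.measurePreserving_swap.quasiMeasurePreserving.ae h)
  filter_upwards [h1] with x hx
  refine integral_congr_ae ?_
  filter_upwards [Measure.ae_ae_of_ae_prod hx] with ν hν
  refine integral_congr_ae ?_
  filter_upwards [hν] with n hn
  simp only [Prod.swap] at hn
  rw [hn]

lemma DivFree.congr_ae {F₁ F₂ : E3 → E3} (h : DivFree Ω F₁)
    (he : ∀ᵐ x ∂(volume.restrict Ω), F₁ x = F₂ x) : DivFree Ω F₂ := by
  intro φ hφ hc hsub
  rw [← h φ hφ hc hsub]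
  refine integral_congr_ae ?_
  filter_upwards [he] with x hx
  rw [hx]

lemma continuous_gradient {φ : E3 → ℝ} (hφ : ContDiff ℝ ∞ φ) : Continuous (gradient φ) :=
  (InnerProductSpace.toDual ℝ E3).symm.continuous.comp (hφ.continuous_fderiv (by simp))

lemma exists_norm_gradient_le {φ : E3 → ℝ} (hφ : ContDiff ℝ ∞ φ) (hc : HasCompactSupport φ) :
    ∃ C, ∀ x, ‖gradient φ x‖ ≤ C := by
  obtain ⟨C, hC⟩ := (hc.fderiv (𝕜 := ℝ)).exists_bound_of_continuous
    (hφ.continuous_fderiv (by simp))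
  exact ⟨C, fun x => by simpa [gradient] using hC x⟩

lemma integral_inner_flux {J : ℝ → E3 → S2 → ℝ}
    (hJ : Integrable (fun q : (ℝ × S2) × E3 => J q.1.1 q.2 q.1.2)
      (rays.prod (volume.restrict Ω))) {φ : E3 → ℝ} (hφ : ContDiff ℝ ∞ φ)
    (hc : HasCompactSupport φ) :
    ∫ x in Ω, inner ℝ (flux J x) (gradient φ x)
      = ∫ p, (∫ x in Ω, J p.1 x p.2 * inner ℝ (p.2 : E3) (gradient φ x)) ∂rays := by
  obtain ⟨C, hC⟩ := exists_norm_gradient_le hφ hc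
  have hg := continuous_gradient hφ
  have hi : Integrable (fun q : (ℝ × S2) × E3 =>
      J q.1.1 q.2 q.1.2 * inner ℝ (q.1.2 : E3) (gradient φ q.2))
      (rays.prod (volume.restrict Ω)) := by
    refine hJ.mul_bdd (c := C) ?_ (ae_of_all _ fun q => ?_)
    · exact Continuous.aestronglyMeasurable (by fun_prop)
    · refine (norm_inner_le_norm _ _).trans ?_
      rw [norm_coe_sphere, one_mul]
      exact hC _
  rw [integral_integral_swap hi]
  refine integral_congr_ae ?_
  filter_upwards [ae_flux_eq hJ] with x hx
  rw [hx.2, real_inner_comm, ← integral_inner hx.1]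
  simp only [real_inner_smul_right, real_inner_comm]

end Flux

section Balance

variable {h c k : ℝ} {Ω : Set E3} {α : ℝ → ℝ} {g : ℝ → S2 → ℝ} {T T₁ T₂ : E3 → ℝ} {M : ℝ}

/-- The data of the transfer problem, with coefficients that are measurable and non-negative
everywhere, not only almost everywhere. -/
structure IsData (h c k : ℝ) (Ω : Set E3) (α : ℝ → ℝ) (g : ℝ → S2 → ℝ) : Prop where
  h_pos : 0 < h
  c_pos : 0 < c
  k_pos : 0 < k
  isOpen : IsOpen Ω
  isBounded : Bornology.IsBounded Ω
  convex : Convex ℝ Ω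
  α_nonneg : ∀ ν, 0 ≤ α ν
  α_measurable : Measurable α
  α_integrable : Integrable α freq
  g_nonneg : ∀ ν n, 0 ≤ g ν n
  g_measurable : Measurable fun p : ℝ × S2 => g p.1 p.2
  g_integrable : Integrable (fun p : ℝ × S2 => g p.1 p.2) rays
  αg_integrable : Integrable (fun p : ℝ × S2 => α p.1 * g p.1 p.2) rays

/-- `T` is a measurable temperature distribution with values in `[0, M]`. -/
structure IsBoundedTemp (M : ℝ) (T : E3 → ℝ) : Prop where
  measurable : Measurable T
  nonneg : ∀ x, 0 ≤ T x
  le : ∀ x, T x ≤ M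

lemma IsBoundedTemp.bound_nonneg (hT : IsBoundedTemp M T) : 0 ≤ M := (hT.nonneg 0).trans (hT.le 0)

/-- The intensity that the temperature distribution `T` and the incoming radiation `g` produce. -/
def intensity (h c k : ℝ) (Ω : Set E3) (α : ℝ → ℝ) (g : ℝ → S2 → ℝ) (T : E3 → ℝ)
    (ν : ℝ) (x : E3) (n : S2) : ℝ :=
  rayIntensity Ω (α ν) n (g ν n) (fun z => planck h c k ν (T z)) x

/-- The absorption `∫∫ α_ν J_ν(x, n) dn dν` at `x` from the intensity `J`. -/
def absorption (α : ℝ → ℝ) (J : ℝ → E3 → S2 → ℝ) (x : E3) : ℝ :=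
  ∫ p, α p.1 * J p.1 x p.2 ∂rays

lemma measurable_planck_comp (hT : Measurable T) (ν : ℝ) :
    Measurable fun z => planck h c k ν (T z) :=
  measurable_planck.comp (measurable_const.prodMk hT)

namespace IsData

lemma measurableSet (d : IsData h c k Ω α g) : MeasurableSet Ω := d.isOpen.measurableSet

lemma isFiniteMeasure (d : IsData h c k Ω α g) : IsFiniteMeasure (volume.restrict Ω : Measure E3) :=
  ⟨by simpa using d.isBounded.measure_lt_top⟩

lemma planck_nonneg (d : IsData h c k Ω α g) (hT : IsBoundedTemp M T) {ν : ℝ}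
    (hν : 0 < ν) (z : E3) :
    0 ≤ planck h c k ν (T z) :=
  RadTransfer.planck_nonneg d.h_pos d.c_pos d.k_pos hν (hT.nonneg z)

lemma planck_le (d : IsData h c k Ω α g) (hT : IsBoundedTemp M T) {ν : ℝ}
    (hν : 0 < ν) (z : E3) :
    planck h c k ν (T z) ≤ planck h c k ν M :=
  planck_mono d.h_pos d.c_pos d.k_pos hν (hT.nonneg z) (hT.le z)

lemma abs_planck_le (d : IsData h c k Ω α g) (hT : IsBoundedTemp M T) {ν : ℝ}
    (hν : 0 < ν) (z : E3) :
    |planck h c k ν (T z)| ≤ planck h c k ν M :=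
  (abs_of_nonneg (d.planck_nonneg hT hν z)).trans_le (d.planck_le hT hν z)

lemma measurable_intensity (d : IsData h c k Ω α g) (hT : Measurable T) :
    Measurable fun q : (ℝ × S2) × E3 => intensity h c k Ω α g T q.1.1 q.2 q.1.2 := by
  have hg : Measurable fun q : (ℝ × S2) × E3 => g q.1.1 q.1.2 := d.g_measurable.comp measurable_fst
  have hα := d.α_measurable
  refine hg.add (measurable_attenuate (P := (ℝ × S2) × E3) (by fun_prop) (by fun_prop) ?_
    measurable_snd)
  have h1 : Measurable fun q : ((ℝ × S2) × E3) × E3 =>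
      planck h c k q.1.1.1 (T q.2) - g q.1.1.1 q.1.1.2 :=
    (measurable_planck.comp (by fun_prop : Measurable
      fun q : ((ℝ × S2) × E3) × E3 => (q.1.1.1, T q.2))).sub (hg.comp measurable_fst)
  exact h1.indicator (measurable_snd d.measurableSet)

lemma intensity_nonneg (d : IsData h c k Ω α g) (hT : IsBoundedTemp M T) {ν : ℝ}
    (hν : 0 < ν) (x : E3) (n : S2) :
    0 ≤ intensity h c k Ω α g T ν x n :=
  rayIntensity_nonneg d.measurableSet (d.α_nonneg ν) (d.g_nonneg ν n)
    (measurable_planck_comp hT.measurable ν) (d.planck_nonneg hT hν) (d.planck_le hT hν) x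

lemma intensity_le (d : IsData h c k Ω α g) (hT : IsBoundedTemp M T) {ν : ℝ}
    (hν : 0 < ν) (x : E3) (n : S2) :
    intensity h c k Ω α g T ν x n ≤ g ν n + planck h c k ν M :=
  rayIntensity_le d.measurableSet (d.α_nonneg ν) (d.g_nonneg ν n)
    (measurable_planck_comp hT.measurable ν) (d.planck_nonneg hT hν) (d.planck_le hT hν) x

lemma abs_intensity_le (d : IsData h c k Ω α g) (hT : IsBoundedTemp M T) {ν : ℝ}
    (hν : 0 < ν) (x : E3) (n : S2) :
    |intensity h c k Ω α g T ν x n| ≤ g ν n + planck h c k ν M :=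
  (abs_of_nonneg (d.intensity_nonneg hT hν x n)).trans_le (d.intensity_le hT hν x n)

lemma integrable_bound (d : IsData h c k Ω α g) (hM : 0 ≤ M) :
    Integrable (fun p : ℝ × S2 => g p.1 p.2 + planck h c k p.1 M) rays :=
  d.g_integrable.add ((integrable_planck d.h_pos d.c_pos d.k_pos hM).comp_fst surf)

lemma integrable_mul_planck_rays (d : IsData h c k Ω α g) (hM : 0 ≤ M) :
    Integrable (fun p : ℝ × S2 => α p.1 * planck h c k p.1 M) rays :=
  (integrable_mul_planck d.h_pos d.c_pos d.k_pos d.α_integrable hM).comp_fst surf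

lemma integrable_mul_bound (d : IsData h c k Ω α g) (hM : 0 ≤ M) :
    Integrable (fun p : ℝ × S2 => α p.1 * (g p.1 p.2 + planck h c k p.1 M)) rays := by
  simp only [mul_add]
  exact d.αg_integrable.add (d.integrable_mul_planck_rays hM)

lemma ae_rays_prod_pos : ∀ᵐ q ∂(rays.prod (volume.restrict Ω)), 0 < q.1.1 :=
  Measure.quasiMeasurePreserving_fst.ae ae_rays_pos

lemma integrable_intensity (d : IsData h c k Ω α g) (hT : IsBoundedTemp M T) :
    Integrable (fun q : (ℝ × S2) × E3 => intensity h c k Ω α g T q.1.1 q.2 q.1.2)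
      (rays.prod (volume.restrict Ω)) := by
  have := d.isFiniteMeasure
  refine ((d.integrable_bound hT.bound_nonneg).comp_fst _).mono'
    (d.measurable_intensity hT.measurable).aestronglyMeasurable ?_
  filter_upwards [ae_rays_prod_pos] with q hq using d.abs_intensity_le hT hq _ _

lemma integrable_mul_intensity (d : IsData h c k Ω α g) (hT : IsBoundedTemp M T) :
    Integrable (fun q : (ℝ × S2) × E3 => α q.1.1 * intensity h c k Ω α g T q.1.1 q.2 q.1.2)
      (rays.prod (volume.restrict Ω)) := by
  have := d.isFiniteMeasure
  refine ((d.integrable_mul_bound hT.bound_nonneg).comp_fst _).mono'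
    ((d.α_measurable.comp (by fun_prop)).mul
      (d.measurable_intensity hT.measurable)).aestronglyMeasurable ?_
  filter_upwards [ae_rays_prod_pos] with q hq
  rw [norm_mul, Real.norm_of_nonneg (d.α_nonneg _)]
  exact mul_le_mul_of_nonneg_left (d.abs_intensity_le hT hq _ _) (d.α_nonneg _)

lemma integrable_mul_intensity_rays (d : IsData h c k Ω α g) (hT : IsBoundedTemp M T) (x : E3) :
    Integrable (fun p : ℝ × S2 => α p.1 * intensity h c k Ω α g T p.1 x p.2) rays := by
  refine (d.integrable_mul_bound hT.bound_nonneg).mono'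
    ((d.α_measurable.comp (by fun_prop)).mul ((d.measurable_intensity hT.measurable).comp
      (measurable_id.prodMk measurable_const))).aestronglyMeasurable ?_
  filter_upwards [ae_rays_pos] with p hp
  rw [norm_mul, Real.norm_of_nonneg (d.α_nonneg _)]
  exact mul_le_mul_of_nonneg_left (d.abs_intensity_le hT hp _ _) (d.α_nonneg _)

lemma integrable_mul_planck_prod (d : IsData h c k Ω α g) (hT : IsBoundedTemp M T) :
    Integrable (fun q : (ℝ × S2) × E3 => α q.1.1 * planck h c k q.1.1 (T q.2))
      (rays.prod (volume.restrict Ω)) := by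
  have := d.isFiniteMeasure
  have hTm := hT.measurable
  refine ((d.integrable_mul_planck_rays hT.bound_nonneg).comp_fst _).mono'
    ((d.α_measurable.comp (by fun_prop)).mul (measurable_planck.comp
      (by fun_prop : Measurable fun q : (ℝ × S2) × E3 => (q.1.1, T q.2)))).aestronglyMeasurable ?_
  filter_upwards [ae_rays_prod_pos] with q hq
  rw [norm_mul, Real.norm_of_nonneg (d.α_nonneg _)]
  exact mul_le_mul_of_nonneg_left (d.abs_planck_le hT hq _) (d.α_nonneg _)

lemma integral_mul_planck_rays (t : ℝ) :
    ∫ p, α p.1 * planck h c k p.1 t ∂rays = surf.real univ * emission h c k α t := by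
  have := integral_prod_mul (μ := freq) (ν := surf) (fun ν => α ν * planck h c k ν t)
    (fun _ => (1 : ℝ))
  simp only [mul_one] at this
  rw [rays, this, emission]
  simp [mul_comm]

/-- The divergence of the flux is emission minus absorption. -/
lemma integral_inner_flux_intensity (d : IsData h c k Ω α g) (hT : IsBoundedTemp M T)
    {φ : E3 → ℝ} (hφ : ContDiff ℝ ∞ φ) (hc : HasCompactSupport φ) (hsub : tsupport φ ⊆ Ω) :
    ∫ x in Ω, inner ℝ (flux (intensity h c k Ω α g T) x) (gradient φ x)
      = ∫ x in Ω, φ x * (absorption α (intensity h c k Ω α g T) x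
          - surf.real univ * emission h c k α (T x)) := by
  obtain ⟨C, hC⟩ := hc.exists_bound_of_continuous hφ.continuous
  have i₁ := d.integrable_mul_intensity hT
  have i₂ := d.integrable_mul_planck_prod hT
  have hi : Integrable (fun q : (ℝ × S2) × E3 =>
      (α q.1.1 * intensity h c k Ω α g T q.1.1 q.2 q.1.2
        - α q.1.1 * planck h c k q.1.1 (T q.2)) * φ q.2) (rays.prod (volume.restrict Ω)) :=
    (i₁.sub i₂).mul_bdd (c := C)
      (hφ.continuous.comp continuous_snd).aestronglyMeasurable (ae_of_all _ fun q => hC _)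
  rw [integral_inner_flux (d.integrable_intensity hT) hφ hc]
  trans ∫ p, (∫ x in Ω, (α p.1 * intensity h c k Ω α g T p.1 x p.2
      - α p.1 * planck h c k p.1 (T x)) * φ x) ∂rays
  · refine integral_congr_ae ?_
    filter_upwards [ae_rays_pos] with p hp
    simp only [← mul_sub]
    exact integral_rayIntensity_mul_inner_gradient d.measurableSet (d.α_nonneg _)
      (measurable_planck_comp hT.measurable _) (d.abs_planck_le hT hp) hφ hc hsub
  · rw [integral_integral_swap hi]
    refine integral_congr_ae ?_
    filter_upwards [i₁.prod_left_ae, i₂.prod_left_ae] with x h₁ h₂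
    rw [integral_mul_const, integral_sub h₁ h₂, integral_mul_planck_rays, mul_comm]
    rfl

lemma measurable_absorption (d : IsData h c k Ω α g) (hT : Measurable T) :
    Measurable (absorption α (intensity h c k Ω α g T)) := by
  have h1 : Measurable fun q : E3 × (ℝ × S2) =>
      α q.2.1 * intensity h c k Ω α g T q.2.1 q.1 q.2.2 :=
    (d.α_measurable.comp (by fun_prop)).mul ((d.measurable_intensity hT).comp measurable_swap)
  exact (h1.stronglyMeasurable.integral_prod_right' (ν := rays)).measurable

lemma integrable_absorption (d : IsData h c k Ω α g) (hT : IsBoundedTemp M T) :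
    Integrable (absorption α (intensity h c k Ω α g T)) (volume.restrict Ω) :=
  (d.integrable_mul_intensity hT).integral_prod_right

lemma integrable_emission (d : IsData h c k Ω α g) (hT : IsBoundedTemp M T) :
    Integrable (fun x => surf.real univ * emission h c k α (T x)) (volume.restrict Ω) := by
  refine (d.integrable_mul_planck_prod hT).integral_prod_right.congr (ae_of_all _ fun x => ?_)
  exact integral_mul_planck_rays (T x)

/-- The flux is divergence-free if and only if emission and absorption balance. -/
lemma divFree_flux_intensity_iff (d : IsData h c k Ω α g) (hT : IsBoundedTemp M T) :
    DivFree Ω (flux (intensity h c k Ω α g T)) ↔ ∀ᵐ x ∂(volume.restrict Ω),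
      absorption α (intensity h c k Ω α g T) x = surf.real univ * emission h c k α (T x) := by
  constructor
  · intro hdiv
    have hi := (d.integrable_absorption hT).sub (d.integrable_emission hT)
    have h1 := d.isOpen.ae_eq_zero_of_integral_contDiff_smul_eq_zero (μ := volume)
      (IntegrableOn.locallyIntegrableOn hi) (fun φ hφ hc hsub => by
        have h2 := hdiv φ hφ hc hsub
        rw [d.integral_inner_flux_intensity hT hφ hc hsub] at h2
        rw [← h2]
        symm
        refine setIntegral_eq_integral_of_forall_compl_eq_zero fun x hx => ?_
        rw [image_eq_zero_of_notMem_tsupport fun h => hx (hsub h), zero_mul])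
    rw [ae_restrict_iff' d.measurableSet]
    filter_upwards [h1] with x hx hxΩ
    exact sub_eq_zero.1 (hx hxΩ)
  · intro hbal φ hφ hc hsub
    rw [d.integral_inner_flux_intensity hT hφ hc hsub]
    refine integral_eq_zero_of_ae ?_
    filter_upwards [hbal] with x hx
    simp [hx]

end IsData

end Balance

/-! ### Existence -/

section Existence

/-- The supremum of the `t ∈ [0, M]` with `f t ≤ u`. It is monotone in `u` for every `f`, also where
there is no such `t` and the value is `0`. -/
def cappedInverse (f : ℝ → ℝ) (M u : ℝ) : ℝ := sSup {t | t ∈ Icc 0 M ∧ f t ≤ u}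

lemma bddAbove_cappedInverse (f : ℝ → ℝ) (M u : ℝ) : BddAbove {t | t ∈ Icc 0 M ∧ f t ≤ u} :=
  ⟨M, fun _ ht => ht.1.2⟩

lemma cappedInverse_nonneg (f : ℝ → ℝ) (M u : ℝ) : 0 ≤ cappedInverse f M u :=
  Real.sSup_nonneg fun _ ht => ht.1.1

lemma cappedInverse_le {f : ℝ → ℝ} {M : ℝ} (hM : 0 ≤ M) (u : ℝ) : cappedInverse f M u ≤ M :=
  Real.sSup_le (fun _ ht => ht.1.2) hM

lemma cappedInverse_mono (f : ℝ → ℝ) (M : ℝ) : Monotone (cappedInverse f M) := by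
  intro u₁ u₂ h
  rcases {t | t ∈ Icc 0 M ∧ f t ≤ u₁}.eq_empty_or_nonempty with he | hne
  · rw [cappedInverse, he, Real.sSup_empty]
    exact cappedInverse_nonneg f M u₂
  · exact csSup_le_csSup (bddAbove_cappedInverse f M u₂) hne fun t ht => ⟨ht.1, ht.2.trans h⟩

lemma apply_cappedInverse {f : ℝ → ℝ} {M u : ℝ} (hM : 0 ≤ M) (hf : ContinuousOn f (Icc 0 M))
    (hmono : MonotoneOn f (Icc 0 M)) (h0 : f 0 ≤ u) (hu : u ≤ f M) :
    f (cappedInverse f M u) = u := by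
  have hcl : IsClosed {t | t ∈ Icc 0 M ∧ f t ≤ u} :=
    hf.preimage_isClosed_of_isClosed isClosed_Icc isClosed_Iic
  have hcpt : IsCompact {t | t ∈ Icc 0 M ∧ f t ≤ u} :=
    isCompact_Icc.of_isClosed_subset hcl fun _ ht => ht.1
  have hmem := hcpt.sSup_mem ⟨0, left_mem_Icc.2 hM, h0⟩
  obtain ⟨t, ht, htu⟩ := intermediate_value_Icc hM hf ⟨h0, hu⟩
  refine le_antisymm hmem.2 ?_
  calc u = f t := htu.symm
    _ ≤ f (cappedInverse f M u) :=
      hmono ht hmem.1 (le_csSup (bddAbove_cappedInverse f M u) ⟨ht, htu.le⟩)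

variable {h c k : ℝ} {Ω : Set E3} {α : ℝ → ℝ} {g : ℝ → S2 → ℝ} {T T₁ T₂ : E3 → ℝ} {M : ℝ}

lemma surf_real_univ_pos : 0 < surf.real univ := by
  have h1 : surf ≠ 0 := Measure.toSphere_ne_zero _
  have := NeZero.mk h1
  exact measureReal_univ_pos

namespace IsData

lemma absorption_mono (d : IsData h c k Ω α g) (hT₁ : IsBoundedTemp M T₁)
    (hT₂ : IsBoundedTemp M T₂) (hT : ∀ x, T₁ x ≤ T₂ x) (x : E3) :
    absorption α (intensity h c k Ω α g T₁) x ≤ absorption α (intensity h c k Ω α g T₂) x := by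
  refine integral_mono_ae (d.integrable_mul_intensity_rays hT₁ x)
    (d.integrable_mul_intensity_rays hT₂ x) ?_
  filter_upwards [ae_rays_pos] with p hp
  refine mul_le_mul_of_nonneg_left ?_ (d.α_nonneg _)
  exact rayIntensity_mono d.measurableSet (d.α_nonneg _) (measurable_planck_comp hT₁.measurable _)
    (d.abs_planck_le hT₁ hp) (measurable_planck_comp hT₂.measurable _) (d.abs_planck_le hT₂ hp)
    (fun z => planck_mono d.h_pos d.c_pos d.k_pos hp (hT₁.nonneg z) (hT z)) x

lemma absorption_nonneg (d : IsData h c k Ω α g) (hT : IsBoundedTemp M T) (x : E3) :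
    0 ≤ absorption α (intensity h c k Ω α g T) x := by
  refine integral_nonneg_of_ae ?_
  filter_upwards [ae_rays_pos] with p hp
  exact mul_nonneg (d.α_nonneg _) (d.intensity_nonneg hT hp x p.2)

/-- A sufficiently high constant temperature emits more than is absorbed from any colder
temperature distribution: the part of its radiation that escapes from `Ω`, at least the fraction
`e^{-α_ν D}`, grows with the temperature and exceeds the incoming radiation. -/
lemma exists_absorption_le (d : IsData h c k Ω α g) : ∃ M, 0 ≤ M ∧ ∀ T, IsBoundedTemp M T →
    ∀ x ∈ Ω, absorption α (intensity h c k Ω α g T) x ≤ surf.real univ * emission h c k α M := by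
  have hS := surf_real_univ_pos
  by_cases hα : ∀ᵐ ν ∂freq, α ν = 0
  · refine ⟨0, le_rfl, fun T hT x _ => ?_⟩
    have h1 : ∀ᵐ p ∂rays, α p.1 = 0 := Measure.quasiMeasurePreserving_fst.ae hα
    have h2 : absorption α (intensity h c k Ω α g T) x = 0 := by
      refine integral_eq_zero_of_ae ?_
      filter_upwards [h1] with p hp
      simp [hp]
    simp [h2]
  obtain ⟨D, hD0, hD⟩ := exists_norm_sub_le d.isBounded
  have hexp : ∀ ν, Real.exp (-α ν * D) ≤ 1 := fun ν =>
    Real.exp_le_one_iff.2 (mul_nonpos_of_nonpos_of_nonneg (neg_nonpos.2 (d.α_nonneg ν)) hD0)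
  have hiexp : ∀ t, 0 ≤ t → Integrable (fun p : ℝ × S2 =>
      Real.exp (-α p.1 * D) * (α p.1 * planck h c k p.1 t)) rays := fun t ht => by
    refine (d.integrable_mul_planck_rays ht).bdd_mul (c := 1) ?_ (ae_of_all _ fun p => ?_)
    · have := d.α_measurable
      exact Measurable.aestronglyMeasurable (by fun_prop)
    · rw [Real.norm_of_nonneg (Real.exp_pos _).le]
      exact hexp _
  set A := ∫ p, α p.1 * g p.1 p.2 ∂rays with hA
  set E := ∫ p, Real.exp (-α p.1 * D) * (α p.1 * planck h c k p.1 1) ∂rays with hE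
  have hEpos : 0 < E := by
    refine lt_of_le_of_ne (integral_nonneg_of_ae ?_) fun h0 => hα ?_
    · filter_upwards [ae_rays_pos] with p hp
      have := RadTransfer.planck_nonneg d.h_pos d.c_pos d.k_pos hp zero_le_one
      have := d.α_nonneg p.1
      positivity
    · have h1 := (integral_eq_zero_iff_of_nonneg_ae (by
        filter_upwards [ae_rays_pos] with p hp
        have := RadTransfer.planck_nonneg d.h_pos d.c_pos d.k_pos hp zero_le_one
        have := d.α_nonneg p.1
        positivity) (hiexp 1 zero_le_one)).1 h0.symm
      have h2 : ∀ᵐ p ∂rays, α p.1 = 0 := by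
        filter_upwards [h1, ae_rays_pos] with p h1 hp
        have h3 := planck_pos d.h_pos d.c_pos d.k_pos hp one_pos
        simpa [h3.ne'] using h1
      have hs0 : surf ≠ 0 := fun h => by simp [h] at hS
      have := NeZero.mk hs0
      filter_upwards [Measure.ae_ae_of_ae_prod h2] with ν hν
      exact hν.exists.choose_spec
  have hM1 : 1 ≤ max 1 (A / E) := le_max_left _ _
  have hM0 : 0 ≤ max 1 (A / E) := zero_le_one.trans hM1
  refine ⟨max 1 (A / E), hM0, fun T hT x hx => ?_⟩
  set M := max 1 (A / E) 
  have i₁ := d.αg_integrable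
  have i₂ := d.integrable_mul_planck_rays hM0
  have i₁₂ : Integrable (fun p : ℝ × S2 =>
      α p.1 * g p.1 p.2 + α p.1 * planck h c k p.1 M) rays := i₁.add i₂
  have i₃ := (hiexp 1 zero_le_one).const_mul M
  calc absorption α (intensity h c k Ω α g T) x
      ≤ ∫ p, (α p.1 * g p.1 p.2 + α p.1 * planck h c k p.1 M
          - M * (Real.exp (-α p.1 * D) * (α p.1 * planck h c k p.1 1))) ∂rays := by
        refine integral_mono_ae (d.integrable_mul_intensity_rays hT x) (i₁₂.sub i₃) ?_
        filter_upwards [ae_rays_pos] with p hp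
        have h1 : intensity h c k Ω α g T p.1 x p.2
            ≤ g p.1 p.2 + (1 - Real.exp (-α p.1 * D)) * planck h c k p.1 M :=
          rayIntensity_le_sub_exp d.measurableSet (d.α_nonneg _) (norm_coe_sphere _)
            (d.g_nonneg _ _) (measurable_planck_comp hT.measurable _) (d.planck_nonneg hT hp)
            (d.planck_le hT hp) hD0 hD hx
        have h2 := mul_planck_one_le d.h_pos d.c_pos d.k_pos hp hM1
        have h3 := mul_le_mul_of_nonneg_left h1 (d.α_nonneg p.1)
        have h4 := mul_le_mul_of_nonneg_left h2
          (mul_nonneg (Real.exp_pos (-α p.1 * D)).le (d.α_nonneg p.1))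
        linarith
    _ = A + surf.real univ * emission h c k α M - M * E := by
        rw [integral_sub i₁₂ i₃, integral_add i₁ i₂, integral_mul_planck_rays,
          integral_const_mul]
    _ ≤ surf.real univ * emission h c k α M := by
        have : A / E ≤ M := le_max_right _ _
        rw [div_le_iff₀ hEpos] at this
        linarith

lemma tendsto_absorption (d : IsData h c k Ω α g) {Tn : ℕ → E3 → ℝ}
    (hTn : ∀ n, IsBoundedTemp M (Tn n)) (hT : IsBoundedTemp M T)
    (hlim : ∀ x, Tendsto (fun n => Tn n x) atTop (𝓝 (T x))) (x : E3) :
    Tendsto (fun n => absorption α (intensity h c k Ω α g (Tn n)) x) atTop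
      (𝓝 (absorption α (intensity h c k Ω α g T) x)) := by
  have hpl : ∀ ν, 0 < ν → ∀ z, Tendsto (fun n => planck h c k ν (Tn n z)) atTop
      (𝓝 (planck h c k ν (T z))) := fun ν hν z =>
    ((continuousOn_planck d.h_pos d.c_pos d.k_pos hν) (T z) (hT.nonneg z)).tendsto.comp
      (tendsto_nhdsWithin_iff.2 ⟨hlim z, Eventually.of_forall fun n => (hTn n).nonneg z⟩)
  refine tendsto_integral_of_dominated_convergence _
    (fun n => (d.integrable_mul_intensity_rays (hTn n) x).aestronglyMeasurable)
    (d.integrable_mul_bound hT.bound_nonneg) (fun n => ?_) ?_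
  · filter_upwards [ae_rays_pos] with p hp
    rw [norm_mul, Real.norm_of_nonneg (d.α_nonneg _)]
    exact mul_le_mul_of_nonneg_left (d.abs_intensity_le (hTn n) hp _ _) (d.α_nonneg _)
  · filter_upwards [ae_rays_pos] with p hp
    refine Tendsto.const_mul _ (Tendsto.const_add _ ?_)
    have hbd : ∀ n z, |Ω.indicator (fun z => planck h c k p.1 (Tn n z) - g p.1 p.2) z|
        ≤ planck h c k p.1 M + |g p.1 p.2| := fun n => abs_indicator_le fun z =>
      (abs_sub _ _).trans (add_le_add_left (d.abs_planck_le (hTn n) hp z) _)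
    have hm : ∀ n, Measurable (Ω.indicator fun z => planck h c k p.1 (Tn n z) - g p.1 p.2) :=
      fun n => ((measurable_planck_comp (hTn n).measurable _).sub_const _).indicator d.measurableSet
    refine tendsto_integral_of_dominated_convergence
      (fun τ => attKernel (α p.1) τ * (planck h c k p.1 M + |g p.1 p.2|))
      (fun n => (integrable_attenuate (d.α_nonneg _) (hm n) (hbd n) x).aestronglyMeasurable)
      ((integrable_attKernel (d.α_nonneg _)).mul_const _) (fun n => ae_of_all _ fun τ => ?_)
      (ae_of_all _ fun τ => ?_)
    · rw [norm_mul, Real.norm_of_nonneg (attKernel_nonneg (d.α_nonneg _) τ)]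
      exact mul_le_mul_of_nonneg_left (hbd n _) (attKernel_nonneg (d.α_nonneg _) τ)
    · refine Tendsto.const_mul _ ?_
      by_cases hz : x - τ • (p.2 : E3) ∈ Ω
      · simpa [hz] using (hpl p.1 hp _).sub_const _
      · simp [hz]

/-- The temperature for which emission balances absorption is the limit of the increasing sequence
that starts from `0` and adapts the temperature at each step to the energy absorbed. -/
lemma exists_balanced_temp (d : IsData h c k Ω α g) : ∃ M T, IsBoundedTemp M T ∧
    ∀ x ∈ Ω,
      absorption α (intensity h c k Ω α g T) x = surf.real univ * emission h c k α (T x) := by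
  have hS := surf_real_univ_pos
  obtain ⟨M, hM0, hM⟩ := d.exists_absorption_le
  set f := emission h c k α with hf
  have hfc : ContinuousOn f (Ici 0) :=
    continuousOn_emission d.h_pos d.c_pos d.k_pos d.α_nonneg d.α_integrable
  have hfm : MonotoneOn f (Ici 0) :=
    emission_monotoneOn d.h_pos d.c_pos d.k_pos d.α_nonneg d.α_integrable
  let next : (E3 → ℝ) → E3 → ℝ := fun T x =>
    cappedInverse f M (absorption α (intensity h c k Ω α g T) x / surf.real univ)
  have hnext : ∀ T, Measurable T → IsBoundedTemp M (next T) := fun T hT =>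
    ⟨(cappedInverse_mono f M).measurable.comp ((d.measurable_absorption hT).div_const _),
      fun x => cappedInverse_nonneg _ _ _, fun x => cappedInverse_le hM0 _⟩
  let Tn : ℕ → E3 → ℝ := fun n => next^[n] fun _ => 0
  have hsucc : ∀ n, Tn (n + 1) = next (Tn n) := fun n => Function.iterate_succ_apply' _ _ _
  have hTn : ∀ n, IsBoundedTemp M (Tn n) := by
    intro n
    induction n with
    | zero => exact ⟨measurable_const, fun x => le_rfl, fun x => hM0⟩
    | succ n ih => rw [hsucc]; exact hnext _ ih.measurable
  have hstep : ∀ n x, Tn n x ≤ Tn (n + 1) x := by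
    intro n
    induction n with
    | zero => exact fun x => (hTn 1).nonneg x
    | succ n ih =>
      intro x
      rw [hsucc n, hsucc (n + 1)]
      refine cappedInverse_mono f M (div_le_div_of_nonneg_right ?_ hS.le)
      exact d.absorption_mono (hTn n) (hTn (n + 1)) ih x
  have hlim : ∀ x, Tendsto (fun n => Tn n x) atTop (𝓝 (⨆ n, Tn n x)) := fun x =>
    tendsto_atTop_ciSup (monotone_nat_of_le_succ fun n => hstep n x)
      ⟨M, by rintro _ ⟨n, rfl⟩; exact (hTn n).le x⟩
  have hT : IsBoundedTemp M fun x => ⨆ n, Tn n x :=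
    ⟨measurable_of_tendsto_metrizable (fun n => (hTn n).measurable) (tendsto_pi_nhds.2 hlim),
      fun x => ge_of_tendsto' (hlim x) fun n => (hTn n).nonneg x,
      fun x => le_of_tendsto' (hlim x) fun n => (hTn n).le x⟩
  refine ⟨M, _, hT, fun x hx => ?_⟩
  have h1 : Tendsto (fun n => surf.real univ * f (Tn (n + 1) x)) atTop
      (𝓝 (surf.real univ * f (⨆ n, Tn n x))) :=
    Tendsto.const_mul _ ((hfc _ (hT.nonneg x)).tendsto.comp (tendsto_nhdsWithin_iff.2
      ⟨(hlim x).comp (tendsto_add_atTop_nat 1), Eventually.of_forall fun n => (hTn _).nonneg x⟩))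
  refine tendsto_nhds_unique (d.tendsto_absorption hTn hT hlim x) (h1.congr fun n => ?_)
  rw [hsucc]
  have h2 : f (next (Tn n) x) = absorption α (intensity h c k Ω α g (Tn n)) x / surf.real univ := by
    refine apply_cappedInverse hM0 (hfc.mono Icc_subset_Ici_self) (hfm.mono Icc_subset_Ici_self)
      ?_ ?_
    · rw [hf, emission_zero]
      exact div_nonneg (d.absorption_nonneg (hTn n) x) hS.le
    · rw [div_le_iff₀ hS, mul_comm]
      exact hM _ (hTn n) x hx
  rw [h2, mul_div_cancel₀ _ hS.ne']

end IsData

end Existence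

/-! ### Uniqueness for the balance of emission and absorption -/

section Uniqueness

variable {h c k : ℝ} {Ω : Set E3} {α : ℝ → ℝ} {g : ℝ → S2 → ℝ} {T T₁ T₂ : E3 → ℝ} {M : ℝ}

lemma IsBoundedTemp.mono {M' : ℝ} (hT : IsBoundedTemp M T) (h : M ≤ M') : IsBoundedTemp M' T :=
  ⟨hT.measurable, hT.nonneg, fun x => (hT.le x).trans h⟩

/-- Attenuated averaging contracts the integral over `Ω`: at least the fraction `e^{-aD}` is
lost. -/
lemma exp_mul_setIntegral_le {a C D : ℝ} {v : E3} {w : E3 → ℝ} (hΩ : MeasurableSet Ω)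
    (hΩfin : volume Ω ≠ ⊤) (ha : 0 ≤ a) (hv : ‖v‖ = 1) (hw : Measurable w) (hw0 : ∀ z, 0 ≤ w z)
    (hC : ∀ z, w z ≤ C) (hD0 : 0 ≤ D) (hD : ∀ x ∈ Ω, ∀ y ∈ Ω, ‖x - y‖ ≤ D) :
    ∫ x in Ω, Real.exp (-a * D) * w x
      ≤ ∫ x in Ω, (w x - attenuate a v (Ω.indicator w) x) := by
  have hwm : Measurable (Ω.indicator w) := hw.indicator hΩ
  have hwC : ∀ z, |Ω.indicator w z| ≤ C := abs_indicator_le fun z =>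
    (abs_of_nonneg (hw0 z)).trans_le (hC z)
  have hC0 : 0 ≤ C := (hw0 0).trans (hC 0)
  have hfin : IsFiniteMeasure (volume.restrict Ω : Measure E3) := ⟨by simpa using hΩfin.lt_top⟩
  have h1 : Integrable (Ω.indicator (1 : E3 → ℝ)) :=
    (integrable_indicator_iff hΩ).2 (integrableOn_const hΩfin)
  have hwi : Integrable w (volume.restrict Ω) :=
    Integrable.of_bound hw.aestronglyMeasurable C (ae_of_all _ fun z => by
      rw [Real.norm_of_nonneg (hw0 z)]; exact hC z)
  have hai : Integrable (attenuate a v (Ω.indicator w)) (volume.restrict Ω) :=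
    Integrable.of_bound (measurable_attenuate (S := fun _ => Ω.indicator w) measurable_const
      measurable_const (hwm.comp measurable_snd) measurable_id).aestronglyMeasurable C
      (ae_of_all _ fun z => abs_attenuate_le ha hwm hwC hC0 z)
  have hai' : Integrable (fun z => w z * attenuate a (-v) (Ω.indicator 1) z)
      (volume.restrict Ω) := by
    refine (integrable_attenuate_of_integrable ha h1).restrict.bdd_mul (c := C)
      hw.aestronglyMeasurable (ae_of_all _ fun z => ?_)
    rw [Real.norm_of_nonneg (hw0 z)]; exact hC z
  have hadj : ∫ x in Ω, attenuate a v (Ω.indicator w) x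
      = ∫ z in Ω, w z * attenuate a (-v) (Ω.indicator 1) z := by
    have h2 := integral_attenuate_mul (v := v) ha hwm hwC h1
    rw [← integral_indicator hΩ, ← integral_indicator hΩ]
    refine (integral_congr_ae (ae_of_all _ fun x => ?_)).trans
      (h2.trans (integral_congr_ae (ae_of_all _ fun x => ?_)))
    · by_cases hx : x ∈ Ω <;> simp [hx]
    · by_cases hx : x ∈ Ω <;> simp [hx]
  rw [integral_sub hwi hai, hadj, ← integral_sub hwi hai']
  refine setIntegral_mono_on (hwi.const_mul _) (hwi.sub hai') hΩ fun x hx => ?_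
  have h3 := attenuate_indicator_one_le (v := -v) hΩ ha (by rwa [norm_neg]) hD0 hD hx
  nlinarith [hw0 x]

namespace IsData

lemma mul_abs_emission_sub (d : IsData h c k Ω α g) (hT₁ : IsBoundedTemp M T₁)
    (hT₂ : IsBoundedTemp M T₂) (x : E3) :
    surf.real univ * |emission h c k α (T₁ x) - emission h c k α (T₂ x)|
      = ∫ p, α p.1 * |planck h c k p.1 (T₁ x) - planck h c k p.1 (T₂ x)| ∂rays := by
  wlog hle : T₂ x ≤ T₁ x generalizing T₁ T₂
  · rw [abs_sub_comm, this hT₂ hT₁ (le_of_not_ge hle)]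
    simp only [abs_sub_comm]
  have hm := emission_monotoneOn d.h_pos d.c_pos d.k_pos d.α_nonneg d.α_integrable
    (hT₂.nonneg x) (hT₁.nonneg x) hle
  rw [abs_of_nonneg (sub_nonneg.2 hm), mul_sub, ← integral_mul_planck_rays,
    ← integral_mul_planck_rays, ← integral_sub (d.integrable_mul_planck_rays (hT₁.nonneg x))
      (d.integrable_mul_planck_rays (hT₂.nonneg x))]
  refine integral_congr_ae ?_
  filter_upwards [ae_rays_pos] with p hp
  rw [abs_of_nonneg (sub_nonneg.2
    (planck_mono d.h_pos d.c_pos d.k_pos hp (hT₂.nonneg x) hle)), mul_sub]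

/-- Temperatures that balance emission and absorption have the same total emission: the difference
of the emissions is dominated by the attenuated average of its absolute value, which has a smaller
integral unless the difference vanishes. -/
lemma emission_unique (d : IsData h c k Ω α g) (hT₁ : IsBoundedTemp M T₁)
    (hT₂ : IsBoundedTemp M T₂)
    (hb₁ : ∀ᵐ x ∂(volume.restrict Ω),
      absorption α (intensity h c k Ω α g T₁) x = surf.real univ * emission h c k α (T₁ x))
    (hb₂ : ∀ᵐ x ∂(volume.restrict Ω),
      absorption α (intensity h c k Ω α g T₂) x = surf.real univ * emission h c k α (T₂ x)) :
    ∀ᵐ x ∂(volume.restrict Ω), emission h c k α (T₁ x) = emission h c k α (T₂ x) := by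
  have := d.isFiniteMeasure
  have hS := surf_real_univ_pos
  have hαm := d.α_measurable
  obtain ⟨D, hD0, hD⟩ := exists_norm_sub_le d.isBounded
  set w : ℝ → E3 → ℝ := fun ν z => |planck h c k ν (T₁ z) - planck h c k ν (T₂ z)| with hw
  have hw0 : ∀ ν z, 0 ≤ w ν z := fun ν z => abs_nonneg _
  have hwle : ∀ ν, 0 < ν → ∀ z, w ν z ≤ planck h c k ν M := fun ν hν z =>
    abs_sub_le_of_nonneg_of_le (d.planck_nonneg hT₁ hν z) (d.planck_le hT₁ hν z)
      (d.planck_nonneg hT₂ hν z) (d.planck_le hT₂ hν z)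
  have hwm' : Measurable fun q : ℝ × E3 => w q.1 q.2 := by
    have h1 := hT₁.measurable
    have h2 := hT₂.measurable
    exact ((measurable_planck.comp (by fun_prop : Measurable fun q : ℝ × E3 => (q.1, T₁ q.2))).sub
      (measurable_planck.comp (by fun_prop : Measurable fun q : ℝ × E3 => (q.1, T₂ q.2)))).abs
  have hwm : ∀ ν, Measurable (w ν) := fun ν => hwm'.comp (measurable_const.prodMk measurable_id)
  have hindC : ∀ ν, 0 < ν → ∀ z, |Ω.indicator (w ν) z| ≤ planck h c k ν M := fun ν hν =>
    abs_indicator_le fun z => (abs_of_nonneg (hw0 ν z)).trans_le (hwle ν hν z)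
  have hpl0 : ∀ ν, 0 < ν → 0 ≤ planck h c k ν M := fun ν hν => (hw0 ν 0).trans (hwle ν hν 0)
  -- The attenuated average of `w` on the product space.
  have hJm : Measurable fun q : (ℝ × S2) × E3 =>
      attenuate (α q.1.1) q.1.2 (Ω.indicator (w q.1.1)) q.2 := by
    refine measurable_attenuate (P := (ℝ × S2) × E3) (by fun_prop) (by fun_prop) ?_ measurable_snd
    have h1 : Measurable fun q : ((ℝ × S2) × E3) × E3 => w q.1.1.1 q.2 :=
      hwm'.comp (by fun_prop : Measurable fun q : ((ℝ × S2) × E3) × E3 => (q.1.1.1, q.2))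
    exact h1.indicator (measurable_snd d.measurableSet)
  have hbound : Integrable (fun q : (ℝ × S2) × E3 => α q.1.1 * planck h c k q.1.1 M)
      (rays.prod (volume.restrict Ω)) :=
    (d.integrable_mul_planck_rays hT₁.bound_nonneg).comp_fst _
  have hiw : Integrable (fun q : (ℝ × S2) × E3 => α q.1.1 * w q.1.1 q.2)
      (rays.prod (volume.restrict Ω)) := by
    refine hbound.mono' ((hαm.comp (by fun_prop)).mul (hwm'.comp (by fun_prop : Measurable
      fun q : (ℝ × S2) × E3 => (q.1.1, q.2)))).aestronglyMeasurable ?_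
    filter_upwards [ae_rays_prod_pos] with q hq
    rw [norm_mul, Real.norm_of_nonneg (d.α_nonneg _), Real.norm_of_nonneg (hw0 _ _)]
    exact mul_le_mul_of_nonneg_left (hwle _ hq _) (d.α_nonneg _)
  have hiJ : Integrable (fun q : (ℝ × S2) × E3 =>
      α q.1.1 * attenuate (α q.1.1) q.1.2 (Ω.indicator (w q.1.1)) q.2)
      (rays.prod (volume.restrict Ω)) := by
    refine hbound.mono' ((hαm.comp (by fun_prop)).mul hJm).aestronglyMeasurable ?_
    filter_upwards [ae_rays_prod_pos] with q hq
    rw [norm_mul, Real.norm_of_nonneg (d.α_nonneg _)]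
    exact mul_le_mul_of_nonneg_left (abs_attenuate_le (d.α_nonneg _)
      ((hwm _).indicator d.measurableSet) (hindC _ hq) (hpl0 _ hq) _) (d.α_nonneg _)
  have hie : Integrable (fun q : (ℝ × S2) × E3 =>
      Real.exp (-α q.1.1 * D) * (α q.1.1 * w q.1.1 q.2)) (rays.prod (volume.restrict Ω)) := by
    refine hiw.bdd_mul (c := 1) (Measurable.aestronglyMeasurable (by fun_prop))
      (ae_of_all _ fun q => ?_)
    rw [Real.norm_of_nonneg (Real.exp_pos _).le]
    exact Real.exp_le_one_iff.2
      (mul_nonpos_of_nonpos_of_nonneg (neg_nonpos.2 (d.α_nonneg _)) hD0)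
  -- Pointwise in `x`, the difference of the emissions is dominated by the average.
  have hpoint : ∀ᵐ x ∂(volume.restrict Ω),
      ∫ p, (α p.1 * w p.1 x - α p.1 * attenuate (α p.1) p.2 (Ω.indicator (w p.1)) x) ∂rays ≤ 0 := by
    filter_upwards [hb₁, hb₂, hiw.prod_left_ae, hiJ.prod_left_ae] with x e₁ e₂ i₁ i₂
    rw [integral_sub i₁ i₂, ← d.mul_abs_emission_sub hT₁ hT₂ x, sub_nonpos]
    calc surf.real univ * |emission h c k α (T₁ x) - emission h c k α (T₂ x)|
        = |∫ p, (α p.1 * intensity h c k Ω α g T₁ p.1 x p.2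
            - α p.1 * intensity h c k Ω α g T₂ p.1 x p.2) ∂rays| := by
          rw [integral_sub (d.integrable_mul_intensity_rays hT₁ x)
            (d.integrable_mul_intensity_rays hT₂ x)]
          change _ = |absorption α _ x - absorption α _ x|
          rw [e₁, e₂, ← mul_sub, abs_mul, abs_of_pos hS]
      _ ≤ _ := by
          refine (abs_integral_le_integral_abs).trans (integral_mono_ae
            ((d.integrable_mul_intensity_rays hT₁ x).sub
              (d.integrable_mul_intensity_rays hT₂ x)).abs i₂ ?_)
          filter_upwards [ae_rays_pos] with p hp
          have hd : Measurable fun z => planck h c k p.1 (T₁ z) - planck h c k p.1 (T₂ z) :=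
            (measurable_planck_comp hT₁.measurable _).sub (measurable_planck_comp hT₂.measurable _)
          have hdC := abs_indicator_le (Ω := Ω) (hwle p.1 hp)
          have hwi := integrable_attenuate (v := (p.2 : E3)) (d.α_nonneg p.1)
            ((hwm p.1).indicator d.measurableSet) (hindC _ hp) x
          rw [← mul_sub, abs_mul, abs_of_nonneg (d.α_nonneg _)]
          refine mul_le_mul_of_nonneg_left ?_ (d.α_nonneg _)
          rw [intensity, intensity, rayIntensity_sub d.measurableSet (d.α_nonneg _)
            (measurable_planck_comp hT₁.measurable _) (d.abs_planck_le hT₁ hp)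
            (measurable_planck_comp hT₂.measurable _) (d.abs_planck_le hT₂ hp)]
          refine (abs_integral_le_integral_abs).trans (integral_mono
            (integrable_attenuate (d.α_nonneg p.1) (hd.indicator d.measurableSet) hdC x).abs
            hwi fun τ => ?_)
          rw [abs_mul, abs_of_nonneg (attKernel_nonneg (d.α_nonneg _) _)]
          refine mul_le_mul_of_nonneg_left (le_of_eq ?_) (attKernel_nonneg (d.α_nonneg _) _)
          by_cases hz : x - τ • (p.2 : E3) ∈ Ω <;> simp [hz, hw]
  have hle : ∫ q, Real.exp (-α q.1.1 * D) * (α q.1.1 * w q.1.1 q.2)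
      ∂(rays.prod (volume.restrict Ω)) ≤ 0 := by
    calc ∫ q, Real.exp (-α q.1.1 * D) * (α q.1.1 * w q.1.1 q.2) ∂(rays.prod (volume.restrict Ω))
        = ∫ p, (∫ x in Ω, Real.exp (-α p.1 * D) * (α p.1 * w p.1 x)) ∂rays := integral_prod _ hie
      _ ≤ ∫ p, (∫ x in Ω, (α p.1 * w p.1 x
            - α p.1 * attenuate (α p.1) p.2 (Ω.indicator (w p.1)) x)) ∂rays := by
          refine integral_mono_ae hie.integral_prod_left (hiw.sub hiJ).integral_prod_left ?_
          filter_upwards [ae_rays_pos] with p hp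
          have h1 := mul_le_mul_of_nonneg_left (exp_mul_setIntegral_le (v := (p.2 : E3))
            d.measurableSet d.isBounded.measure_lt_top.ne (d.α_nonneg p.1) (norm_coe_sphere _)
            (hwm p.1) (hw0 p.1) (hwle p.1 hp) hD0 hD) (d.α_nonneg p.1)
          rw [← integral_const_mul, ← integral_const_mul] at h1
          simpa only [mul_sub, mul_left_comm (α p.1)] using h1
      _ = ∫ x in Ω, (∫ p, (α p.1 * w p.1 x
            - α p.1 * attenuate (α p.1) p.2 (Ω.indicator (w p.1)) x) ∂rays) :=
          integral_integral_swap (hiw.sub hiJ)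
      _ ≤ 0 := integral_nonpos_of_ae hpoint
  have hnn : ∀ q : (ℝ × S2) × E3, 0 ≤ Real.exp (-α q.1.1 * D) * (α q.1.1 * w q.1.1 q.2) :=
    fun q => mul_nonneg (Real.exp_pos _).le (mul_nonneg (d.α_nonneg _) (hw0 _ _))
  have hzero := (integral_eq_zero_iff_of_nonneg hnn hie).1
    (le_antisymm hle (integral_nonneg hnn))
  have hzero' := Measure.ae_ae_of_ae_prod
    (Measure.measurePreserving_swap.quasiMeasurePreserving.ae hzero)
  filter_upwards [hzero'] with x hx
  have h1 := d.mul_abs_emission_sub hT₁ hT₂ x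
  have h2 : ∫ p, α p.1 * |planck h c k p.1 (T₁ x) - planck h c k p.1 (T₂ x)| ∂rays = 0 := by
    refine integral_eq_zero_of_ae ?_
    filter_upwards [hx] with p hp
    exact (mul_eq_zero.1 hp).resolve_left (Real.exp_pos _).ne'
  rw [h2] at h1
  exact sub_eq_zero.1 (abs_eq_zero.1 ((mul_eq_zero.1 h1).resolve_left hS.ne'))

end IsData

end Uniqueness

/-! ### Solutions of the system -/

section Solutions

variable {h c k : ℝ} {Ω : Set E3} {α α₀ : ℝ → ℝ} {g g₀ : ℝ → S2 → ℝ} {T T' : E3 → ℝ}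
  {I : ℝ → E3 → S2 → ℝ} {M : ℝ}

lemma ae_pos_and_mem (hΩ : MeasurableSet Ω) :
    ∀ᵐ p ∂(freq.prod ((volume.restrict Ω).prod surf)), 0 < p.1 ∧ p.2.1 ∈ Ω := by
  have h1 : ∀ᵐ p ∂(freq.prod ((volume.restrict Ω).prod surf)), 0 < p.1 :=
    Measure.quasiMeasurePreserving_fst.ae ae_freq_pos
  have h2 : ∀ᵐ p ∂((volume.restrict Ω).prod surf), p.1 ∈ Ω :=
    Measure.quasiMeasurePreserving_fst.ae (ae_restrict_mem hΩ)
  filter_upwards [h1, Measure.quasiMeasurePreserving_snd.ae h2] with p hp hp' using ⟨hp, hp'⟩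

lemma emission_congr_ae (hα : ∀ᵐ ν ∂freq, α₀ ν = α ν) (t : ℝ) :
    emission h c k α₀ t = emission h c k α t := by
  refine integral_congr_ae ?_
  filter_upwards [hα] with ν hν
  rw [hν]

lemma IsSolution.congr_ae (hI : IsSolution h c k Ω α g T I) (hα : ∀ᵐ ν ∂freq, α₀ ν = α ν) :
    IsSolution h c k Ω α₀ g T I where
  aemeasurable := hI.aemeasurable
  nonneg := hI.nonneg
  integrable := hI.integrable
  boundary := hI.boundary
  transport := by
    filter_upwards [hI.transport, Measure.quasiMeasurePreserving_fst.ae hα] with p hp hαp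
    rwa [hαp]
  conservation := hI.conservation

/-- Changing the incoming intensity on a null set changes the intensity on a null set. -/
lemma intensity_congr_ae (hg : ∀ᵐ p ∂rays, g₀ p.1 p.2 = g p.1 p.2) :
    ∀ᵐ q ∂(rays.prod (volume.restrict Ω)), intensity h c k Ω α g₀ T q.1.1 q.2 q.1.2
      = intensity h c k Ω α g T q.1.1 q.2 q.1.2 := by
  filter_upwards [Measure.quasiMeasurePreserving_fst.ae hg] with q hq
  rw [intensity, intensity, hq]

namespace IsData

/-- A bounded temperature that balances emission and absorption solves the system. -/
lemma isSolution_intensity (d : IsData h c k Ω α g)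
    (hg : ∀ᵐ p ∂rays, g₀ p.1 p.2 = g p.1 p.2) (hT : IsBoundedTemp M T)
    (hbal : ∀ᵐ x ∂(volume.restrict Ω),
      absorption α (intensity h c k Ω α g T) x = surf.real univ * emission h c k α (T x)) :
    IsSolution h c k Ω α g₀ T (intensity h c k Ω α g₀ T) where
  aemeasurable := hT.measurable.aemeasurable
  nonneg := ae_of_all _ hT.nonneg
  integrable := by
    have h1 : Integrable (fun q : (ℝ × S2) × E3 => intensity h c k Ω α g₀ T q.1.1 q.2 q.1.2)
        (rays.prod (volume.restrict Ω)) :=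
      (d.integrable_intensity hT).congr (by
        filter_upwards [intensity_congr_ae (h := h) (c := c) (k := k) (α := α) (T := T) hg]
          with q hq using hq.symm)
    exact (measurePreserving_rays Ω).integrable_comp_of_integrable h1
  boundary := fun ν _ x hx N hN n hn => rayIntensity_of_forall_notMem fun _ ht =>
    sub_smul_notMem_of_inner_neg d.isOpen d.convex hx hN hn ht
  transport := by
    filter_upwards [ae_pos_and_mem d.measurableSet] with p hp
    exact rayIntensity_transport d.isOpen d.isBounded d.convex
      (measurable_planck_comp hT.measurable p.1) (d.abs_planck_le hT hp.1) hp.2 p.2.2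
  conservation := by
    refine ((d.divFree_flux_intensity_iff hT).2 hbal).congr_ae (flux_congr_ae ?_)
    filter_upwards [intensity_congr_ae (h := h) (c := c) (k := k) (α := α) (T := T) hg] with q hq
      using hq.symm

/-- The intensity of a solution with bounded temperature is given by the explicit formula. -/
lemma ae_eq_intensity (d : IsData h c k Ω α g) (hΩ1 : HasC1Boundary Ω)
    (hI : IsSolution h c k Ω α g₀ T I) (hT' : IsBoundedTemp M T')
    (hTT' : ∀ᵐ x ∂(volume.restrict Ω), T x = T' x) :
    ∀ᵐ q ∂(rays.prod (volume.restrict Ω)),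
      I q.1.1 q.2 q.1.2 = intensity h c k Ω α g₀ T' q.1.1 q.2 q.1.2 := by
  have hnull : volume {x | ¬ (x ∈ Ω → T x = T' x)} = 0 :=
    (ae_restrict_iff' d.measurableSet).1 hTT'
  have h1 : ∀ᵐ p ∂((volume.restrict Ω).prod surf), ∀ᵐ t : ℝ,
      entryPoint Ω p.1 p.2 + t • (p.2 : E3) ∉ {x | ¬ (x ∈ Ω → T x = T' x)} := by
    have hac : (volume.restrict Ω).prod surf ≪ (volume : Measure E3).prod surf :=
      Measure.restrict_le_self.absolutelyContinuous.prod Measure.AbsolutelyContinuous.rfl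
    exact hac.ae_le (ae_ae_entryPoint_add_smul_notMem hnull)
  have h2 : ∀ᵐ p ∂(freq.prod ((volume.restrict Ω).prod surf)),
      I p.1 p.2.1 p.2.2 = intensity h c k Ω α g₀ T' p.1 p.2.1 p.2.2 := by
    filter_upwards [hI.transport, ae_pos_and_mem d.measurableSet,
      Measure.quasiMeasurePreserving_snd.ae h1] with p htr hp hray
    obtain ⟨N, hN⟩ := hΩ1 _ (entryPoint_mem_frontier d.isOpen d.isBounded d.convex hp.2 p.2.2)
    refine eq_rayIntensity (u := fun x => I p.1 x p.2.2) (b' := fun z => planck h c k p.1 (T z))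
      d.isOpen d.isBounded d.convex (measurable_planck_comp hT'.measurable p.1)
      (d.abs_planck_le hT' hp.1) hp.2 p.2.2 htr.1 htr.2 ?_ ?_
    · exact hI.boundary p.1 hp.1 _
        (entryPoint_mem_frontier d.isOpen d.isBounded d.convex hp.2 p.2.2) N hN p.2.2
        (inner_outwardNormal_entryPoint_neg d.isOpen d.isBounded d.convex hp.2 p.2.2 hN)
    · filter_upwards [hray] with t ht hmem
      rw [not_not.1 ht hmem]
  exact (measurePreserving_rays_symm Ω).quasiMeasurePreserving.ae h2

/-- Unless `α` vanishes, the temperature of a solution with bounded total emission is bounded, and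
it balances emission and absorption. -/
lemma exists_isBoundedTemp_of_isTemperatureSolution (d : IsData h c k Ω α g)
    (hΩ1 : HasC1Boundary Ω) (hα : ∀ᵐ ν ∂freq, α₀ ν = α ν)
    (hg : ∀ᵐ p ∂rays, g₀ p.1 p.2 = g p.1 p.2) (hne : ¬ ∀ᵐ ν ∂freq, α ν = 0)
    (hT : IsTemperatureSolution h c k Ω α₀ g₀ T) :
    ∃ M T', IsBoundedTemp M T' ∧ (∀ᵐ x ∂(volume.restrict Ω), T x = T' x) ∧
      ∀ᵐ x ∂(volume.restrict Ω),
        absorption α (intensity h c k Ω α g T') x = surf.real univ * emission h c k α (T' x) := by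
  obtain ⟨hmem, -, I, hI₀⟩ := hT
  have hI : IsSolution h c k Ω α g₀ T I :=
    hI₀.congr_ae (by filter_upwards [hα] with ν hν using hν.symm)
  have hf1 : 0 < emission h c k α 1 := by
    have := emission_strictMonoOn d.h_pos d.c_pos d.k_pos d.α_nonneg d.α_integrable hne
      (mem_Ici.2 le_rfl) (mem_Ici.2 zero_le_one) one_pos
    rwa [emission_zero] at this
  obtain ⟨K, hK⟩ : ∃ K : ℝ, ∀ᵐ x ∂(volume.restrict Ω), ‖emission h c k α₀ (T x)‖ ≤ K := by
    have hlt := hmem.2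
    rw [eLpNorm_exponent_top] at hlt
    refine ⟨(eLpNormEssSup (fun x => emission h c k α₀ (T x)) (volume.restrict Ω)).toReal, ?_⟩
    filter_upwards [ae_le_eLpNormEssSup (f := fun x => emission h c k α₀ (T x))
      (μ := volume.restrict Ω)] with x hx
    rw [← toReal_enorm]
    exact ENNReal.toReal_mono hlt.ne hx
  set M := max 1 (K / emission h c k α 1)
  have hM0 : 0 ≤ M := zero_le_one.trans (le_max_left _ _)
  have hTM : ∀ᵐ x ∂(volume.restrict Ω), T x ≤ M := by
    filter_upwards [hK] with x hx
    rcases le_total (T x) 1 with h1 | h1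
    · exact h1.trans (le_max_left _ _)
    · refine le_max_of_le_right ?_
      rw [le_div_iff₀ hf1]
      rw [emission_congr_ae hα] at hx
      exact (mul_emission_one_le d.h_pos d.c_pos d.k_pos d.α_nonneg d.α_integrable h1).trans
        ((le_abs_self _).trans hx)
  obtain ⟨S, hSm, hS⟩ := hI.aemeasurable
  have hT' : IsBoundedTemp M fun x => max 0 (min M (S x)) :=
    ⟨measurable_const.max (measurable_const.min hSm), fun x => le_max_left _ _,
      fun x => max_le hM0 (min_le_left _ _)⟩
  have hTT' : ∀ᵐ x ∂(volume.restrict Ω), T x = max 0 (min M (S x)) := by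
    filter_upwards [hTM, hI.nonneg, hS] with x h1 h2 h3
    rw [← h3, min_eq_right h1, max_eq_right h2]
  refine ⟨M, _, hT', hTT', (d.divFree_flux_intensity_iff hT').1 ?_⟩
  refine hI.conservation.congr_ae (flux_congr_ae ?_)
  filter_upwards [d.ae_eq_intensity hΩ1 hI hT' hTT', intensity_congr_ae hg] with q h1 h2
  rw [h1, h2]

end IsData

end Solutions

end RadTransfer

end

theorem theorem3p2 (h c k : ℝ) (hh : 0 < h) (hc : 0 < c) (hk : 0 < k)
    (Ω : Set RadTransfer.E3) (hΩo : IsOpen Ω) (hΩne : Ω.Nonempty)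
    (hΩb : Bornology.IsBounded Ω) (hΩc : Convex ℝ Ω) (hΩ1 : RadTransfer.HasC1Boundary Ω)
    (α : ℝ → ℝ) (hα0 : ∀ ν : ℝ, 0 < ν → 0 ≤ α ν) (hα : Integrable α RadTransfer.freq)
    (g : ℝ → RadTransfer.S2 → ℝ) (hg0 : ∀ ν : ℝ, 0 < ν → ∀ n : RadTransfer.S2, 0 ≤ g ν n)
    (hg : Integrable (fun p : ℝ × RadTransfer.S2 => g p.1 p.2)
      (RadTransfer.freq.prod RadTransfer.surf))
    (hαg : Integrable (fun p : ℝ × RadTransfer.S2 => α p.1 ^ 2 * g p.1 p.2)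
      (RadTransfer.freq.prod RadTransfer.surf)) :
    (∃ T : RadTransfer.E3 → ℝ, RadTransfer.IsTemperatureSolution h c k Ω α g T) ∧
    (∀ T₁ T₂ : RadTransfer.E3 → ℝ,
      RadTransfer.IsTemperatureSolution h c k Ω α g T₁ →
      RadTransfer.IsTemperatureSolution h c k Ω α g T₂ →
      (∀ᵐ x ∂(volume.restrict Ω),
        RadTransfer.emission h c k α (T₁ x) = RadTransfer.emission h c k α (T₂ x)) ∧
      (¬ (∀ᵐ ν ∂(RadTransfer.freq), α ν = 0) →
        ∀ᵐ x ∂(volume.restrict Ω), T₁ x = T₂ x)) := by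
  open RadTransfer in
  -- Replace the coefficients by everywhere non-negative measurable ones.
  obtain ⟨α₁, hα₁m, hα₁⟩ := hα.aestronglyMeasurable
  obtain ⟨g₁, hg₁m, hg₁⟩ := hg.aestronglyMeasurable
  have hαα : ∀ᵐ ν ∂freq, α ν = max 0 (α₁ ν) := by
    filter_upwards [hα₁, ae_freq_pos] with ν h1 h2
    rw [← h1, max_eq_right (hα0 ν h2)]
  have hgg : ∀ᵐ p ∂rays, g p.1 p.2 = max 0 (g₁ (p.1, p.2)) := by
    filter_upwards [hg₁, ae_rays_pos] with p h1 h2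
    rw [← h1, max_eq_right (hg0 p.1 h2 p.2)]
  have hααr : ∀ᵐ p ∂rays, α p.1 = max 0 (α₁ p.1) := Measure.quasiMeasurePreserving_fst.ae hαα
  have hα₁m' : Measurable fun ν => max 0 (α₁ ν) := measurable_const.max hα₁m.measurable
  have hg₁m' : Measurable fun p : ℝ × S2 => max 0 (g₁ (p.1, p.2)) :=
    measurable_const.max hg₁m.measurable
  have hgi : Integrable (fun p : ℝ × S2 => max 0 (g₁ (p.1, p.2))) rays := hg.congr hgg
  have d : IsData h c k Ω (fun ν => max 0 (α₁ ν)) (fun ν n => max 0 (g₁ (ν, n))) :=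
    { h_pos := hh, c_pos := hc, k_pos := hk, isOpen := hΩo, isBounded := hΩb, convex := hΩc
      α_nonneg := fun ν => le_max_left _ _
      α_measurable := hα₁m'
      α_integrable := hα.congr hαα
      g_nonneg := fun ν n => le_max_left _ _
      g_measurable := hg₁m'
      g_integrable := hgi
      αg_integrable := by
        refine (hg.add hαg).mono' ((hα₁m'.comp measurable_fst).mul hg₁m').aestronglyMeasurable ?_
        filter_upwards [hgg, hααr, ae_rays_pos] with p h1 h2 hp
        rw [← h1, ← h2, Real.norm_of_nonneg (mul_nonneg (hα0 _ hp) (hg0 _ hp _))]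
        have := hg0 _ hp p.2
        simp only [Pi.add_apply]
        nlinarith [sq_nonneg (α p.1 - 1), sq_nonneg (α p.1)] }
  have hem : ∀ t, emission h c k α t = emission h c k (fun ν => max 0 (α₁ ν)) t :=
    emission_congr_ae hαα
  refine ⟨?_, fun T₁ T₂ hT₁ hT₂ => ?_⟩
  · obtain ⟨M, T, hT, hbal⟩ := d.exists_balanced_temp
    have hmono := emission_monotoneOn d.h_pos d.c_pos d.k_pos d.α_nonneg d.α_integrable
    have hnn : ∀ x, 0 ≤ emission h c k α (T x) := fun x => by
      rw [hem]
      exact emission_nonneg d.h_pos d.c_pos d.k_pos d.α_nonneg d.α_integrable (hT.nonneg x)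
    refine ⟨T, ?_, ae_of_all _ hnn, intensity h c k Ω (fun ν => max 0 (α₁ ν)) g T, ?_⟩
    · have hm : Measurable fun x => emission h c k α (T x) := by
        simp only [hem]
        have h1 : Measurable fun q : E3 × ℝ => max 0 (α₁ q.2) * planck h c k q.2 (T q.1) := by
          have hTm := hT.measurable
          exact (hα₁m'.comp measurable_snd).mul (measurable_planck.comp
            (by fun_prop : Measurable fun q : E3 × ℝ => (q.2, T q.1)))
        exact (h1.stronglyMeasurable.integral_prod_right' (ν := freq)).measurable
      refine memLp_top_of_bound hm.aestronglyMeasurable (emission h c k α M)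
        (ae_of_all _ fun x => ?_)
      rw [Real.norm_of_nonneg (hnn x), hem, hem]
      exact hmono (hT.nonneg x) hT.bound_nonneg (hT.le x)
    · exact (d.isSolution_intensity hgg hT (by
        filter_upwards [ae_restrict_mem hΩo.measurableSet] with x hx using hbal x hx)).congr_ae hαα
  · by_cases hz : ∀ᵐ ν ∂freq, α ν = 0
    · refine ⟨ae_of_all _ fun x => ?_, fun hne => absurd hz hne⟩
      have h0 : ∀ t, emission h c k α t = 0 := fun t => by
        refine integral_eq_zero_of_ae ?_
        filter_upwards [hz] with ν hν
        simp [hν]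
      rw [h0, h0]
    · have hne : ¬ ∀ᵐ ν ∂freq, max 0 (α₁ ν) = 0 := fun h => hz (by
        filter_upwards [hαα, h] with ν h1 h2
        rw [h1, h2])
      obtain ⟨M₁, S₁, hS₁, e₁, b₁⟩ :=
        d.exists_isBoundedTemp_of_isTemperatureSolution hΩ1 hαα hgg hne hT₁
      obtain ⟨M₂, S₂, hS₂, e₂, b₂⟩ :=
        d.exists_isBoundedTemp_of_isTemperatureSolution hΩ1 hαα hgg hne hT₂
      have huniq := d.emission_unique (hS₁.mono (le_max_left M₁ M₂)) (hS₂.mono (le_max_right M₁ M₂))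
        b₁ b₂
      constructor
      · filter_upwards [huniq, e₁, e₂] with x h1 h2 h3
        rw [h2, h3, hem, hem, h1]
      · intro _
        filter_upwards [huniq, e₁, e₂] with x h1 h2 h3
        rw [h2, h3]
        exact (emission_strictMonoOn d.h_pos d.c_pos d.k_pos d.α_nonneg d.α_integrable
          hne).injOn (hS₁.nonneg x) (hS₂.nonneg x) h1
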